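/- **Setting.** Consider a game with finitely many players $i\in\mathcal N$. Player $i$ chooses an action in a compact convex set $\mathcal X_i\subseteq\mathbb R^{d_i}$, $d_i\ge 1$, which contains a closed Euclidean ball of radius $r_i>0$ centred at $p_i$. Write $\mathcal X=\prod_i\mathcal X_i$, and let $u_i:\mathcal X\to\mathbb R$ be the payoff function of player $i$, bounded and Borel measurable (e.g. continuous) and concave in $x_i\in\mathcal X_i$ for every fixed $x_{-i}$. Assume that the individual payoff gradients $v_i(x)=\nabla_{x_i}u_i(x_i;x_{-i})$ exist and are Lipschitz continuous on $\mathcal X$, and that the game is monotone (diagonal strict concavity): there are $\lambda_i>0$ with $\sum_i\lambda_i\langle v_i(x')-v_i(x),x_i'-x_i\rangle<0$ for all $x\ne x'$ in $\mathcal X$. A Nash equilibrium is a profile $x^*\in\mathcal X$ with $u_i(x_i;x^*_{-i})\le u_i(x^*)$ for all $i$ and all $x_i\in\mathcal X_i$. For each player let $h_i:\mathcal X_i\to\mathbb R$ be continuous and strongly convex. Let $\partial h_i(x)=\{y:\ h_i(x')\ge h_i(x)+\langle y,x'-x\rangle\ \text{for all } x'\in\mathcal X_i\}$ and $\operatorname{dom}\partial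 h_i=\{x\in\mathcal X_i:\partial h_i(x)\ne\varnothing\}$, and let $\nabla h_i$ be a continuous selection of $\partial h_i$ on $\operatorname{dom}\partial h_i$. Let $D_i(q,x)=h_i(q)-h_i(x)-\langle\nabla h_i(x),q-x\rangle$ for $q\in\mathcal X_i$, $x\in\operatorname{dom}\partial h_i$, and assume that $D_i(q,x)\to0$ whenever $x\to q$ in $\operatorname{dom}\partial h_i$, for every $q\in\mathcal X_i$ (Bregman reciprocity). Define the prox-mapping $P^i_x(y)=\arg\min_{x'\in\mathcal X_i}\{\langle y,x-x'\rangle+D_i(x',x)\}$. **Algorithm.** Let $\gamma_n>0$ and $0<\delta_n<\min_i r_i$, $n\ge1$. Let $Z_{i,n}$ be uniformly distributed on the unit sphere of $\mathbb R^{d_i}$, independent across players $i$ and stages $n$, and independent of the (possibly random) initial point $X_1\in\prod_i\operatorname{dom}\partial h_i$. For all $n\ge1$ and all $i$ set $$\hat X_{i,n}=X_{i,n}+\delta_n\bigl(Z_{i,n}-r_i^{-1}(X_{i,n}-p_i)\bigr),\qquad \hat v_{i,n}=\frac{d_i}{\delta_n}\,u_i(\hat X_n)\,Z_{i,n},\qquad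 X_{i,n+1}=P^i_{X_{i,n}}(\gamma_n\hat v_{i,n}).$$ **Theorem.** If $\gamma_n\to0$, $\delta_n\to0$, $\sum_n\gamma_n=\infty$, $\sum_n\gamma_n\delta_n<\infty$ and $\sum_n\gamma_n^2/\delta_n^2<\infty$, then the game has a Nash equilibrium $x^*\in\mathcal X$ such that the realized actions satisfy $\hat X_n\to x^*$ almost surely. -/

import Mathlib

open MeasureTheory ProbabilityTheory Filter Topology Set
open scoped RealInnerProductSpace

noncomputable section

/-- Action profiles `x = (x_i)_i`, where player `i` acts in the Euclidean space `ℝ^{d i}`. -/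
abbrev Profile {ι : Type*} (d : ι → ℕ) : Type _ := ∀ i, EuclideanSpace ℝ (Fin (d i))

/-- A concave game: compact convex action sets, and payoff functions that are concave in the
player's own action. Only the values of `payoff i` on the product of the action sets matter. -/
structure ConcaveGame (ι : Type*) [Fintype ι] [DecidableEq ι] (d : ι → ℕ) where
  /-- the action set of each player -/
  act : ∀ i, Set (EuclideanSpace ℝ (Fin (d i)))
  /-- the payoff function of each player -/
  payoff : ι → Profile d → ℝ
  isCompact_act : ∀ i, IsCompact (act i)
  convex_act : ∀ i, Convex ℝ (act i)
  concave_payoff : ∀ i, ∀ x ∈ Set.univ.pi act,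
    ConcaveOn ℝ (act i) (fun y => payoff i (Function.update x i y))

namespace ConcaveGame

variable {ι : Type*} [Fintype ι] [DecidableEq ι] {d : ι → ℕ} (G : ConcaveGame ι d)

/-- The action space of the game, i.e. the product of the players' action sets. -/
def actionSpace : Set (Profile d) := Set.univ.pi G.act

/-- Nash equilibrium: no player gains by a unilateral deviation. -/
def IsNash (x : Profile d) : Prop :=
  x ∈ G.actionSpace ∧
    ∀ i, ∀ y ∈ G.act i, G.payoff i (Function.update x i y) ≤ G.payoff i x

/-- The individual payoff gradient of player `i`: the gradient of the payoff of `i` with respect to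
the action of `i`, relative to the action set of `i`. -/
def payoffGrad (i : ι) (x : Profile d) : EuclideanSpace ℝ (Fin (d i)) :=
  gradientWithin (fun y => G.payoff i (Function.update x i y)) (G.act i) (x i)

/-- The individual payoff gradients exist and are Lipschitz continuous on the action space. -/
def HasLipschitzGradients : Prop :=
  ∀ i, (∀ x ∈ G.actionSpace, DifferentiableWithinAt ℝ
      (fun y => G.payoff i (Function.update x i y)) (G.act i) (x i)) ∧
    ∃ L : NNReal, LipschitzOnWith L (G.payoffGrad i) G.actionSpace

/-- The payoff functions are Borel measurable and bounded on the action space. -/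
def HasBoundedMeasurablePayoffs : Prop :=
  ∀ i, Measurable (fun x : G.actionSpace => G.payoff i x) ∧
    ∃ C : ℝ, ∀ x ∈ G.actionSpace, |G.payoff i x| ≤ C

/-- Monotone game: diagonal strict concavity, for some positive weights. -/
def IsMonotone : Prop :=
  ∃ w : ι → ℝ, (∀ i, 0 < w i) ∧
    ∀ x ∈ G.actionSpace, ∀ x' ∈ G.actionSpace, x ≠ x' →
      ∑ i, w i * ⟪G.payoffGrad i x' - G.payoffGrad i x, x' i - x i⟫ < 0

end ConcaveGame

section Regularizer

variable {E : Type*} [NormedAddCommGroup E] [InnerProductSpace ℝ E]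

/-- The subdifferential at `x` of the function equal to `h` on `K` and to `+∞` outside `K`. -/
def subdiff (K : Set E) (h : E → ℝ) (x : E) : Set E :=
  {y | ∀ x' ∈ K, h x + ⟪y, x' - x⟫ ≤ h x'}

/-- The domain of subdifferentiability. -/
def subdiffDomain (K : Set E) (h : E → ℝ) : Set E :=
  {x | x ∈ K ∧ (subdiff K h x).Nonempty}

/-- The Bregman divergence `D(p, x)` of `h`, for the selection `dh` of subgradients. -/
def bregman (h : E → ℝ) (dh : E → E) (p x : E) : ℝ :=
  h p - h x - ⟪dh x, p - x⟫

/-- `h` is a regularizer on `K`: continuous, strongly convex, with a continuous selection `dh` of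
its subdifferential, and such that `D(p, x) → 0` when `x → p` (Bregman reciprocity). -/
structure IsRegularizer (K : Set E) (h : E → ℝ) (dh : E → E) : Prop where
  continuousOn : ContinuousOn h K
  strongConvexOn : ∃ m : ℝ, 0 < m ∧ StrongConvexOn K m h
  selection_mem : ∀ x ∈ subdiffDomain K h, dh x ∈ subdiff K h x
  selection_continuousOn : ContinuousOn dh (subdiffDomain K h)
  reciprocity : ∀ p ∈ K,
    Tendsto (fun x => bregman h dh p x) (𝓝[subdiffDomain K h] p) (𝓝 0)

/-- `xnew` is the value at `y` of the prox-mapping based at `x`, i.e. it minimizes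
`x' ↦ ⟪y, x - x'⟫ + D(x', x)` over `K` (the minimizer is unique when `h` is strongly convex). -/
def IsProx (K : Set E) (h : E → ℝ) (dh : E → E) (x y xnew : E) : Prop :=
  xnew ∈ K ∧ IsMinOn (fun x' => ⟪y, x - x'⟫ + bregman h dh x' x) K xnew

end Regularizer

/-- The unit sphere of `ℝ^n`. -/
abbrev UnitSphere (n : ℕ) : Type := Metric.sphere (0 : EuclideanSpace ℝ (Fin n)) 1

/-- The uniform distribution on the unit sphere of `ℝ^n` (`n ≥ 1`): normalized surface measure. -/
def uniformSphere (n : ℕ) : Measure (UnitSphere n) :=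
  ((volume : Measure (EuclideanSpace ℝ (Fin n))).toSphere Set.univ)⁻¹ •
    (volume : Measure (EuclideanSpace ℝ (Fin n))).toSphere

section Algorithm

variable {ι : Type*} [Fintype ι] [DecidableEq ι] {d : ι → ℕ}

/-- The realized action profile `x + δ w` at pivot `x`, where `w i = z i - (x i - p i) / r i` is the
sampled direction `z i` after the feasibility adjustment with safety ball of centre `p i` and
radius `r i`. -/
def realizedAction (p : Profile d) (r : ι → ℝ) (δ : ℝ) (x : Profile d)
    (z : ∀ i, UnitSphere (d i)) : Profile d :=
  fun i => x i + δ • ((z i : EuclideanSpace ℝ (Fin (d i))) - (r i)⁻¹ • (x i - p i))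

/-- The one-point SPSA estimate `(d i / δ) u_i(xhat) z_i`, when `xhat` is the action profile that
has been played. -/
def spsaEstimate (G : ConcaveGame ι d) (δ : ℝ) (xhat : Profile d) (z : ∀ i, UnitSphere (d i))
    (i : ι) : EuclideanSpace ℝ (Fin (d i)) :=
  ((d i : ℝ) / δ * G.payoff i xhat) • (z i : EuclideanSpace ℝ (Fin (d i)))

/-- `X` is the sequence of pivots of multi-agent mirror descent with bandit feedback, with sampled
directions `Z`, step sizes `γ` and query radii `δ`. The first pivot may be random, as long as it is
independent of the directions (a deterministic first pivot is a special case). -/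
structure IsBanditMirrorDescent {Ω : Type*} [MeasurableSpace Ω] (P : Measure Ω)
    (G : ConcaveGame ι d)
    (h : ∀ i, EuclideanSpace ℝ (Fin (d i)) → ℝ)
    (dh : ∀ i, EuclideanSpace ℝ (Fin (d i)) → EuclideanSpace ℝ (Fin (d i)))
    (p : Profile d) (r : ι → ℝ) (γ δ : ℕ → ℝ)
    (X : ℕ → Ω → Profile d) (Z : ℕ → ∀ i, Ω → UnitSphere (d i)) : Prop where
  measurable_direction : ∀ n i, Measurable (Z n i)
  law_direction : ∀ n i, P.map (Z n i) = uniformSphere (d i)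
  indep_direction : iIndepFun (fun (q : ℕ × ι) ω => Z q.1 q.2 ω) P
  measurable_init : Measurable (X 0)
  indep_init : IndepFun (X 0) (fun ω (q : ℕ × ι) => Z q.1 q.2 ω) P
  init_mem : ∀ ω i, X 0 ω i ∈ subdiffDomain (G.act i) (h i)
  step : ∀ n ω i, IsProx (G.act i) (h i) (dh i) (X n ω i)
    (γ n • spsaEstimate G (δ n)
      (realizedAction p r (δ n) (X n ω) (fun j => Z n j ω)) (fun j => Z n j ω) i)
    (X (n + 1) ω i)

end Algorithm

end

/-! Let `q` solve the weighted variational inequality of the game: no feasible `y` makes the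
weighted sum of the products of `payoffGrad i q` with `y i - q i` positive. Lipschitz continuity and
monotonicity give existence, and concavity makes `q` a Nash equilibrium. By strict monotonicity, `ψ
x`, minus the weighted sum of the products of `payoffGrad i x` with `x i - q i`, is positive for
every feasible `x ≠ q`.

The Lyapunov function is the weighted Bregman divergence from `q` to the pivot. By
`exists_weightedBregman_prox_le`, a step changes it by at most `γ` times the weighted pairing of the
estimate with `X - q`, plus `O(γ ^ 2 / δ ^ 2)`, since the estimate has size `O(1 / δ)`.
Conditionally on the past, the estimate is the payoff gradient up to `O(δ)`
(`exists_abs_integral_spsaEstimate_sub_le`), so the drift is `-γ ψ + O(γ δ)`. The centered part is a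
martingale difference of size `O(γ / δ)`, and its series converges almost surely
(`ae_tendsto_sum_of_orthogonal`).

A Robbins-Siegmund argument then shows that the divergence converges and that `∑ γ ψ` is finite. As
`∑ γ` diverges, `ψ` is small infinitely often, so by compactness the pivots return to every
neighbourhood of `q`. Bregman reciprocity forces the limit of the divergence to be zero, and strong
convexity turns this into convergence of the pivots. Realized actions differ from pivots by `O(δ)`.
-/

noncomputable section

/-! ### Symmetries and second moments of the uniform law on the sphere. -/

section SphereMeasure

/-- The action of a linear isometry on the unit sphere. -/
def sphereMap {n : ℕ} (e : EuclideanSpace ℝ (Fin n) ≃ₗᵢ[ℝ] EuclideanSpace ℝ (Fin n))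
    (z : UnitSphere n) : UnitSphere n :=
  ⟨e z, by simp⟩

theorem continuous_sphereMap {n : ℕ}
    (e : EuclideanSpace ℝ (Fin n) ≃ₗᵢ[ℝ] EuclideanSpace ℝ (Fin n)) :
    Continuous (sphereMap e) :=
  (e.continuous.comp continuous_subtype_val).subtype_mk _

instance isFiniteMeasure_uniformSphere (n : ℕ) : IsFiniteMeasure (uniformSphere n) := by
  rcases eq_or_ne ((volume : Measure (EuclideanSpace ℝ (Fin n))).toSphere univ) 0 with h | h
  · have h0 : (volume : Measure (EuclideanSpace ℝ (Fin n))).toSphere = 0 :=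
      Measure.measure_univ_eq_zero.1 h
    rw [uniformSphere, h0, smul_zero]
    infer_instance
  · exact Measure.smul_finite _ (ENNReal.inv_ne_top.2 h)

theorem isProbabilityMeasure_uniformSphere {n : ℕ} (hn : n ≠ 0) :
    IsProbabilityMeasure (uniformSphere n) := by
  constructor
  have h : (volume : Measure (EuclideanSpace ℝ (Fin n))).toSphere univ ≠ 0 := by
    rw [Ne, Measure.measure_univ_eq_zero, Measure.toSphere_eq_zero_iff_finrank]
    simpa using hn
  rw [uniformSphere, Measure.smul_apply, smul_eq_mul,
    ENNReal.inv_mul_cancel h (measure_ne_top _ _)]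

/-- The surface measure of a set is a multiple of the volume of the cone over it; an isometry maps
cones to cones and preserves volume. -/
theorem measurePreserving_sphereMap {n : ℕ}
    (e : EuclideanSpace ℝ (Fin n) ≃ₗᵢ[ℝ] EuclideanSpace ℝ (Fin n)) :
    MeasurePreserving (sphereMap e) (uniformSphere n) (uniformSphere n) := by
  refine ⟨(continuous_sphereMap e).measurable, ?_⟩
  rw [uniformSphere, Measure.map_smul]
  congr 1
  ext s hs
  have hs' := (continuous_sphereMap e).measurable hs
  rw [Measure.map_apply (continuous_sphereMap e).measurable hs, Measure.toSphere_apply' _ hs,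
    Measure.toSphere_apply' _ hs']
  congr 1
  refine Eq.trans ?_ (e.measurePreserving.measure_preimage_equiv (f := e.toMeasurableEquiv) _)
  congr 1
  ext x
  constructor
  · rintro ⟨t, ht, _, ⟨z, hz, rfl⟩, rfl⟩
    exact ⟨t, ht, _, ⟨sphereMap e z, hz, rfl⟩, (map_smul e t _).symm⟩
  · rintro ⟨t, ht, _, ⟨z, hz, rfl⟩, hx⟩
    have hz' : sphereMap e (sphereMap e.symm z) = z := Subtype.ext (e.apply_symm_apply _)
    refine ⟨t, ht, _, ⟨sphereMap e.symm z, (by rw [hz']; exact hz :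
      sphereMap e (sphereMap e.symm z) ∈ s), rfl⟩, ?_⟩
    apply e.injective
    change t • (z : EuclideanSpace ℝ (Fin n)) = e x at hx
    change e (t • e.symm z) = e x
    rw [← hx, map_smul, e.apply_symm_apply]

theorem continuous_sphere_coord {n : ℕ} (j : Fin n) :
    Continuous fun z : UnitSphere n => (z : EuclideanSpace ℝ (Fin n)) j := by
  fun_prop

theorem integrable_uniformSphere_of_continuous {n : ℕ} {f : UnitSphere n → ℝ} (hf : Continuous f) :
    Integrable f (uniformSphere n) :=
  hf.integrable_of_hasCompactSupport (HasCompactSupport.of_compactSpace f)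

/-- Reflecting the `j`-th coordinate preserves the measure and changes the sign of the integrand. -/
theorem integral_sphere_coord_mul_coord_of_ne {n : ℕ} {j k : Fin n} (hjk : j ≠ k) :
    ∫ z : UnitSphere n, (z : EuclideanSpace ℝ (Fin n)) j * (z : EuclideanSpace ℝ (Fin n)) k
      ∂uniformSphere n = 0 := by
  let e : EuclideanSpace ℝ (Fin n) ≃ₗᵢ[ℝ] EuclideanSpace ℝ (Fin n) :=
    LinearIsometryEquiv.piLpCongrRight 2
      fun l => if l = j then LinearIsometryEquiv.neg ℝ else LinearIsometryEquiv.refl ℝ ℝ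
  have h := (measurePreserving_sphereMap e).integral_comp'
    (f := ⟨⟨sphereMap e, sphereMap e.symm, fun z => Subtype.ext (e.symm_apply_apply _),
      fun z => Subtype.ext (e.apply_symm_apply _)⟩, (continuous_sphereMap e).measurable,
      (continuous_sphereMap e.symm).measurable⟩)
    (fun z : UnitSphere n => (z : EuclideanSpace ℝ (Fin n)) j * (z : EuclideanSpace ℝ (Fin n)) k)
  have h2 : ∀ z : UnitSphere n, (sphereMap e z : EuclideanSpace ℝ (Fin n)) j *
      (sphereMap e z : EuclideanSpace ℝ (Fin n)) k = -((z : EuclideanSpace ℝ (Fin n)) j *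
      (z : EuclideanSpace ℝ (Fin n)) k) := by
    intro z
    simp [sphereMap, e, hjk.symm]
  simp only [MeasurableEquiv.coe_mk, Equiv.coe_fn_mk, h2, integral_neg] at h
  linarith

theorem integral_sphere_coord_sq_eq {n : ℕ} (j k : Fin n) :
    ∫ z : UnitSphere n, (z : EuclideanSpace ℝ (Fin n)) j ^ 2 ∂uniformSphere n =
      ∫ z : UnitSphere n, (z : EuclideanSpace ℝ (Fin n)) k ^ 2 ∂uniformSphere n := by
  let e : EuclideanSpace ℝ (Fin n) ≃ₗᵢ[ℝ] EuclideanSpace ℝ (Fin n) :=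
    LinearIsometryEquiv.piLpCongrLeft 2 ℝ ℝ (Equiv.swap j k)
  have h := (measurePreserving_sphereMap e).integral_comp'
    (f := ⟨⟨sphereMap e, sphereMap e.symm, fun z => Subtype.ext (e.symm_apply_apply _),
      fun z => Subtype.ext (e.apply_symm_apply _)⟩, (continuous_sphereMap e).measurable,
      (continuous_sphereMap e.symm).measurable⟩)
    (fun z : UnitSphere n => (z : EuclideanSpace ℝ (Fin n)) k ^ 2)
  rw [← h]
  refine integral_congr_ae (Eventually.of_forall fun z => ?_)
  simp [sphereMap, e, LinearIsometryEquiv.piLpCongrLeft_apply, Equiv.piCongrLeft']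

theorem sum_sphere_coord_sq {n : ℕ} (z : UnitSphere n) :
    ∑ j, (z : EuclideanSpace ℝ (Fin n)) j ^ 2 = 1 := by
  have h := EuclideanSpace.real_norm_sq_eq (z : EuclideanSpace ℝ (Fin n))
  rw [← h, norm_eq_of_mem_sphere, one_pow]

/-- The coordinates have equal second moments by symmetry, and their squares sum to one. -/
theorem mul_integral_sphere_coord_sq {n : ℕ} (j : Fin n) :
    (n : ℝ) * ∫ z : UnitSphere n, (z : EuclideanSpace ℝ (Fin n)) j ^ 2 ∂uniformSphere n = 1 := by
  have := isProbabilityMeasure_uniformSphere (n := n) (by have := j.2; omega)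
  calc _ = ∑ k : Fin n, ∫ z : UnitSphere n, (z : EuclideanSpace ℝ (Fin n)) k ^ 2
        ∂uniformSphere n := by
        rw [Finset.sum_congr rfl fun k _ => integral_sphere_coord_sq_eq k j]; simp
    _ = ∫ z : UnitSphere n, ∑ k : Fin n, (z : EuclideanSpace ℝ (Fin n)) k ^ 2
        ∂uniformSphere n :=
        (integral_finsetSum _ fun k _ =>
          integrable_uniformSphere_of_continuous ((continuous_sphere_coord k).pow 2)).symm
    _ = 1 := by simp [sum_sphere_coord_sq]

/-- The second moment of the uniform distribution on the unit sphere of `ℝ^n` is `1 / n` times the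
inner product. -/
theorem mul_integral_inner_mul_inner_uniformSphere {n : ℕ} (v a : EuclideanSpace ℝ (Fin n)) :
    (n : ℝ) * ∫ z : UnitSphere n, ⟪v, (z : EuclideanSpace ℝ (Fin n))⟫ *
      ⟪(z : EuclideanSpace ℝ (Fin n)), a⟫ ∂uniformSphere n = ⟪v, a⟫ := by
  have h1 : ∀ z : UnitSphere n, ⟪v, (z : EuclideanSpace ℝ (Fin n))⟫ *
      ⟪(z : EuclideanSpace ℝ (Fin n)), a⟫ = ∑ j, ∑ k, (v j * a k) *
        ((z : EuclideanSpace ℝ (Fin n)) j * (z : EuclideanSpace ℝ (Fin n)) k) := by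
    intro z
    simp only [PiLp.inner_apply, Finset.sum_mul_sum, RCLike.inner_apply, conj_trivial]
    exact Finset.sum_congr rfl fun j _ => Finset.sum_congr rfl fun k _ => by ring
  have hint : ∀ j k : Fin n, Integrable (fun z : UnitSphere n => (v j * a k) *
      ((z : EuclideanSpace ℝ (Fin n)) j * (z : EuclideanSpace ℝ (Fin n)) k)) (uniformSphere n) :=
    fun j k => integrable_uniformSphere_of_continuous
      (((continuous_sphere_coord j).mul (continuous_sphere_coord k)).const_mul _)
  simp only [h1]
  rw [integral_finsetSum _ fun j _ => integrable_finsetSum _ fun k _ => hint j k, Finset.mul_sum]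
  simp only [PiLp.inner_apply, RCLike.inner_apply, conj_trivial]
  refine Finset.sum_congr rfl fun j _ => ?_
  rw [integral_finsetSum _ fun k _ => hint j k, Finset.sum_eq_single j]
  · simp only [integral_const_mul, ← sq]
    linear_combination (v j * a j) * mul_integral_sphere_coord_sq j
  · intro k _ hk
    rw [integral_const_mul, integral_sphere_coord_mul_coord_of_ne hk.symm, mul_zero]
  · simp

end SphereMeasure

/-! ### Monotone variational inequalities in an inner product space. -/

section VariationalInequality

variable {E : Type*} [NormedAddCommGroup E] [InnerProductSpace ℝ E]

/-- Adding the variational characterizations of the two projections gives firm nonexpansiveness;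
Cauchy-Schwarz then gives the Lipschitz bound. -/
theorem exists_projection {K : Set E} (hne : K.Nonempty) (hK : IsComplete K) (hconv : Convex ℝ K) :
    ∃ π : E → E, (∀ u, π u ∈ K) ∧ (∀ u, ∀ y ∈ K, ⟪u - π u, y - π u⟫ ≤ 0) ∧
      ∀ u u', ‖π u - π u'‖ ≤ ‖u - u'‖ := by
  choose π hπ hmin using exists_norm_eq_iInf_of_complete_convex hne hK hconv
  have hvar : ∀ u, ∀ y ∈ K, ⟪u - π u, y - π u⟫ ≤ 0 := fun u =>
    (norm_eq_iInf_iff_real_inner_le_zero hconv (hπ u)).1 (hmin u)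
  refine ⟨π, hπ, hvar, fun u u' => ?_⟩
  have h1 := hvar u _ (hπ u')
  have h2 := hvar u' _ (hπ u)
  have h3 : ‖π u - π u'‖ ^ 2 ≤ ⟪u - u', π u - π u'⟫ := by
    have h4 : ⟪u - π u, π u' - π u⟫ = -⟪u, π u - π u'⟫ + ⟪π u, π u - π u'⟫ := by
      rw [← neg_sub (π u) (π u'), inner_neg_right, inner_sub_left]
      ring
    rw [inner_sub_left] at h2
    rw [← real_inner_self_eq_norm_sq, inner_sub_left, inner_sub_left]
    linarith
  have h4 := h3.trans (real_inner_le_norm _ _)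
  by_contra! h5
  nlinarith [norm_nonneg (u - u'), norm_nonneg (π u - π u')]

/-- A strongly monotone variational inequality with Lipschitz data has a solution. -/
theorem exists_variational_solution_of_pos {K : Set E} (hne : K.Nonempty) (hK : IsComplete K)
    (hconv : Convex ℝ K) {F : E → E} {L : ℝ} (hL : ∀ x ∈ K, ∀ y ∈ K, ‖F x - F y‖ ≤ L * ‖x - y‖)
    (hmono : ∀ x ∈ K, ∀ y ∈ K, ⟪F x - F y, x - y⟫ ≤ 0) {ε : ℝ} (hε : 0 < ε) :
    ∃ x ∈ K, ∀ y ∈ K, ⟪F x - ε • x, y - x⟫ ≤ 0 := by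
  obtain ⟨π, hπ, hvar, hlip⟩ := exists_projection hne hK hconv
  obtain ⟨A, hA⟩ : ∃ A, A = ε ^ 2 + L ^ 2 := ⟨_, rfl⟩
  have hApos : 0 < A := by rw [hA]; positivity
  -- This step size gives `(1 - α * ε) ^ 2 + α ^ 2 * L ^ 2 = 1 - α * ε`, the squared contraction
  -- factor of the projected step `T`. Fixed points of `T` solve the inequality.
  obtain ⟨α, hα⟩ : ∃ α, α = ε / A := ⟨_, rfl⟩
  have hαpos : 0 < α := by rw [hα]; positivity
  have hαA : α * A = ε := by rw [hα]; field_simp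
  have hαε : α * ε ≤ 1 := by
    rw [hα, div_mul_eq_mul_div, div_le_one hApos, hA]
    nlinarith [sq_nonneg L]
  have hαε0 : 0 < α * ε := mul_pos hαpos hε
  let T : E → E := fun x => π (x + α • (F x - ε • x))
  have hT : MapsTo T K K := fun x _ => hπ _
  have hsq : ∀ x ∈ K, ∀ y ∈ K, ‖T x - T y‖ ^ 2 ≤ (1 - α * ε) * ‖x - y‖ ^ 2 := by
    intro x hx y hy
    have h1 : ‖T x - T y‖ ≤ ‖(1 - α * ε) • (x - y) + α • (F x - F y)‖ := by
      refine (hlip _ _).trans (le_of_eq (congrArg _ ?_))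
      module
    have h2 : ‖(1 - α * ε) • (x - y) + α • (F x - F y)‖ ^ 2 =
        (1 - α * ε) ^ 2 * ‖x - y‖ ^ 2 + 2 * ((1 - α * ε) * α * ⟪F x - F y, x - y⟫) +
          α ^ 2 * ‖F x - F y‖ ^ 2 := by
      rw [norm_add_sq_real, norm_smul, norm_smul, real_inner_smul_left, real_inner_smul_right,
        real_inner_comm, mul_pow, mul_pow, Real.norm_eq_abs, Real.norm_eq_abs, sq_abs, sq_abs]
      ring
    have h3 : ‖F x - F y‖ ^ 2 ≤ L ^ 2 * ‖x - y‖ ^ 2 := by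
      rw [← mul_pow]
      exact pow_le_pow_left₀ (norm_nonneg _) (hL x hx y hy) 2
    have h4 : (1 - α * ε) * α * ⟪F x - F y, x - y⟫ ≤ 0 :=
      mul_nonpos_of_nonneg_of_nonpos (mul_nonneg (by linarith) hαpos.le) (hmono x hx y hy)
    have h5 : α ^ 2 * (ε ^ 2 + L ^ 2) = α * ε := by
      rw [← hA, sq, mul_assoc, hαA]
    calc ‖T x - T y‖ ^ 2 ≤ ‖(1 - α * ε) • (x - y) + α • (F x - F y)‖ ^ 2 :=
          pow_le_pow_left₀ (norm_nonneg _) h1 2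
      _ ≤ (1 - α * ε) ^ 2 * ‖x - y‖ ^ 2 + α ^ 2 * (L ^ 2 * ‖x - y‖ ^ 2) := by
          rw [h2]
          linarith [mul_le_mul_of_nonneg_left h3 (sq_nonneg α)]
      _ = (1 - α * ε) * ‖x - y‖ ^ 2 := by
          linear_combination ‖x - y‖ ^ 2 * h5
  let q : NNReal := Real.toNNReal (Real.sqrt (1 - α * ε))
  have hq1 : q < 1 := by
    rw [Real.toNNReal_lt_one]
    exact (Real.sqrt_lt' one_pos).2 (by linarith)
  have hcontr : ContractingWith q (hT.restrict T K K) := by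
    refine ⟨hq1, LipschitzWith.of_dist_le_mul fun x y => ?_⟩
    rw [Subtype.dist_eq, Subtype.dist_eq, dist_eq_norm, dist_eq_norm,
      Real.coe_toNNReal _ (Real.sqrt_nonneg _)]
    refine abs_le_of_sq_le_sq' ?_ (by positivity) |>.2
    rw [mul_pow, Real.sq_sqrt (by linarith)]
    exact hsq _ x.2 _ y.2
  obtain ⟨x0, hx0⟩ := hne
  obtain ⟨x, hx, hfix, -⟩ := hcontr.exists_fixedPoint' hK hT hx0 (edist_ne_top _ _)
  refine ⟨x, hx, fun y hy => ?_⟩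
  have h1 := hvar (x + α • (F x - ε • x)) y hy
  have h2 : π (x + α • (F x - ε • x)) = x := hfix
  rw [h2, add_sub_cancel_left, real_inner_smul_left] at h1
  exact nonpos_of_mul_nonpos_right h1 hαpos

/-- A monotone variational inequality with Lipschitz data on a compact convex set has a
solution. -/
theorem exists_variational_solution {K : Set E} (hne : K.Nonempty) (hK : IsCompact K)
    (hconv : Convex ℝ K) {F : E → E} {L : ℝ} (hL : ∀ x ∈ K, ∀ y ∈ K, ‖F x - F y‖ ≤ L * ‖x - y‖)
    (hmono : ∀ x ∈ K, ∀ y ∈ K, ⟪F x - F y, x - y⟫ ≤ 0) :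
    ∃ x ∈ K, ∀ y ∈ K, ⟪F x, y - x⟫ ≤ 0 := by
  -- Tikhonov regularization with `ε = 1 / (n + 1)`; any cluster point of the regularized solutions
  -- solves the limiting inequality.
  choose u hu hvar using fun n : ℕ => exists_variational_solution_of_pos hne hK.isComplete hconv hL
    hmono (Nat.one_div_pos_of_nat (α := ℝ) (n := n))
  obtain ⟨x, hx, φ, hφ, hlim⟩ := hK.tendsto_subseq hu
  refine ⟨x, hx, fun y hy => ?_⟩
  have hε : Tendsto (fun n => 1 / ((φ n : ℝ) + 1)) atTop (𝓝 0) :=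
    tendsto_one_div_add_atTop_nhds_zero_nat.comp hφ.tendsto_atTop
  have hF : Tendsto (fun n => F (u (φ n))) atTop (𝓝 (F x)) := by
    rw [tendsto_iff_norm_sub_tendsto_zero]
    have h0 := (tendsto_iff_norm_sub_tendsto_zero.1 hlim).const_mul L
    rw [mul_zero] at h0
    exact squeeze_zero (fun _ => norm_nonneg _) (fun n => hL _ (hu _) _ hx) h0
  have hlim' : Tendsto (fun n => ⟪F (u (φ n)) - (1 / ((φ n : ℝ) + 1)) • u (φ n), y - u (φ n)⟫)
      atTop (𝓝 ⟪F x - (0 : ℝ) • x, y - x⟫) :=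
    (hF.sub (hε.smul hlim)).inner (tendsto_const_nhds.sub hlim)
  rw [zero_smul, sub_zero] at hlim'
  exact le_of_tendsto hlim' (Eventually.of_forall fun n => hvar (φ n) y hy)

end VariationalInequality

/-! ### Tangent inequality for concave functions. -/

section Concave

variable {E : Type*} [NormedAddCommGroup E] [InnerProductSpace ℝ E] [CompleteSpace E]

/-- A concave function lies below its tangent. -/
theorem ConcaveOn.le_add_inner_gradientWithin {K : Set E} {f : E → ℝ} (hf : ConcaveOn ℝ K f)
    {x y : E} (hx : x ∈ K) (hy : y ∈ K) (hd : DifferentiableWithinAt ℝ f K x) :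
    f y ≤ f x + ⟪gradientWithin f K x, y - x⟫ := by
  -- The derivative exists only within `K`, so `f` is restricted to the segment: the chord slope is
  -- at most the one-sided derivative at `0`.
  let ℓ : ℝ → E := AffineMap.lineMap x y
  have hmaps : MapsTo ℓ (Icc 0 1) K := fun t ht => hf.1.lineMap_mem hx hy ht
  have hc : ConcaveOn ℝ (Icc 0 1) (f ∘ ℓ) :=
    (hf.comp_affineMap (AffineMap.lineMap x y)).subset hmaps (convex_Icc 0 1)
  have hℓ0 : ℓ 0 = x := AffineMap.lineMap_apply_zero x y
  have hℓ1 : ℓ 1 = y := AffineMap.lineMap_apply_one x y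
  have hder : HasDerivWithinAt (f ∘ ℓ) ⟪gradientWithin f K x, y - x⟫ (Icc 0 1) 0 := by
    have h1 : HasFDerivWithinAt f (InnerProductSpace.toDual ℝ E (gradientWithin f K x)) K (ℓ 0) := by
      rw [hℓ0]
      exact hd.hasGradientWithinAt.hasFDerivWithinAt
    exact h1.comp_hasDerivWithinAt 0 AffineMap.hasDerivWithinAt_lineMap hmaps
  have hs := hc.slope_le_of_hasDerivWithinAt_Ioi (x := 0) (y := 1) (by simp) (by simp) one_pos
    (hder.mono_of_mem_nhdsWithin (Icc_mem_nhdsGT one_pos))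
  rw [slope_def_field] at hs
  simp only [Function.comp, hℓ0, hℓ1, sub_zero, div_one] at hs
  linarith

end Concave

/-! ### Subgradients, Bregman divergences and the prox-mapping. -/

section Subdifferential

variable {E : Type*} [NormedAddCommGroup E] [InnerProductSpace ℝ E]
  {K : Set E} {h : E → ℝ} {dh : E → E}

/-- A continuous convex function is subdifferentiable at interior points. -/
theorem interior_subset_subdiffDomain [CompleteSpace E] (hconv : ConvexOn ℝ K h)
    (hcont : ContinuousOn h K) : interior K ⊆ subdiffDomain K h := by
  intro x hx
  have hxK := interior_subset hx
  -- Separate `(x, h x)` from the open strict epigraph over the interior. The vertical component `c`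
  -- of the functional is negative, and rescaling by `(-c)⁻¹` gives the subgradient.
  let A : Set (E × ℝ) := {q | q.1 ∈ interior K ∧ h q.1 < q.2}
  have hAconv : Convex ℝ A :=
    (hconv.subset interior_subset hconv.1.interior).convex_strict_epigraph
  have hAopen : IsOpen A := by
    have h1 : ContinuousOn (fun q : E × ℝ => h q.1 - q.2) (Prod.fst ⁻¹' interior K) :=
      ((hcont.mono interior_subset).comp continuousOn_fst fun _ hq => hq).sub continuousOn_snd
    have h2 := h1.isOpen_inter_preimage (isOpen_interior.preimage continuous_fst) (isOpen_Iio (a := 0))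
    convert h2 using 1
    ext q
    simp [A]
  have hxA : (x, h x) ∉ A := fun hq => lt_irrefl _ hq.2
  obtain ⟨f, hf⟩ := geometric_hahn_banach_open_point hAconv hAopen hxA
  let l : E →L[ℝ] ℝ := f.comp (ContinuousLinearMap.inl ℝ E ℝ)
  obtain ⟨c, hc⟩ : ∃ c, c = f (0, 1) := ⟨_, rfl⟩
  have hfl : ∀ z t, f (z, t) = l z + t * c := fun z t => by
    have h1 : (z, t) = (z, (0 : ℝ)) + t • ((0 : E), (1 : ℝ)) := by simp
    rw [h1, map_add, map_smul, hc, smul_eq_mul]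
    rfl
  have hcneg : c < 0 := by
    have h1 := hf (x, h x + 1) ⟨hx, by simp⟩
    rw [hfl, hfl] at h1
    linarith
  have hint : ∀ z ∈ interior K, l z + h z * c ≤ l x + h x * c := fun z hz => by
    have h1 : Tendsto (fun t : ℝ => l z + t * c) (𝓝[>] (h z)) (𝓝 (l z + h z * c)) :=
      (Continuous.tendsto (by fun_prop) _).mono_left nhdsWithin_le_nhds
    refine le_of_tendsto h1 ?_
    filter_upwards [self_mem_nhdsWithin] with t ht
    have h2 := hf (z, t) ⟨hz, ht⟩
    rw [hfl, hfl] at h2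
    exact h2.le
  -- The midpoint of `x` and `z` is interior, so convexity carries the inequality over to boundary
  -- points.
  have hall : ∀ z ∈ K, l z + h z * c ≤ l x + h x * c := fun z hz => by
    have h1 := hconv.2 hxK hz (by norm_num : (0 : ℝ) ≤ 1 / 2) (by norm_num : (0 : ℝ) ≤ 1 / 2)
      (by norm_num)
    have h2 := hint ((1 / 2 : ℝ) • x + (1 / 2 : ℝ) • z)
      (hconv.1.combo_interior_self_mem_interior hx hz (by norm_num) (by norm_num) (by norm_num))
    rw [map_add, map_smul, map_smul] at h2
    simp only [smul_eq_mul] at h1 h2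
    nlinarith
  refine ⟨hxK, (InnerProductSpace.toDual ℝ E).symm ((-c)⁻¹ • l), fun z hz => ?_⟩
  rw [InnerProductSpace.toDual_symm_apply, _root_.smul_apply, smul_eq_mul, map_sub,
    ← le_sub_iff_add_le', inv_mul_le_iff₀ (by linarith)]
  nlinarith [hall z hz]

theorem monotone_subdiff {x y g g' : E} (hx : x ∈ K) (hy : y ∈ K) (hg : g ∈ subdiff K h x)
    (hg' : g' ∈ subdiff K h y) : 0 ≤ ⟪g' - g, y - x⟫ := by
  have h1 := hg y hy
  have h2 := hg' x hx
  rw [← neg_sub y x, inner_neg_right] at h2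
  rw [inner_sub_left]
  linarith

/-- Subgradient inequality for strongly convex functions. -/
theorem StrongConvexOn.add_inner_add_sq_le {m : ℝ} (hm : StrongConvexOn K m h) {x g q : E}
    (hx : x ∈ K) (hq : q ∈ K) (hg : g ∈ subdiff K h x) :
    h x + ⟪g, q - x⟫ + m / 4 * ‖q - x‖ ^ 2 ≤ h q := by
  -- Testing at the midpoint alone yields the constant `m / 4`, which suffices here.
  have h1 := hm.2 hx hq (by norm_num : (0 : ℝ) ≤ 1 / 2) (by norm_num : (0 : ℝ) ≤ 1 / 2)
    (by norm_num)
  have h2 := hg _ (hm.1 hx hq (by norm_num : (0 : ℝ) ≤ 1 / 2) (by norm_num : (0 : ℝ) ≤ 1 / 2)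
    (by norm_num))
  have h3 : (1 / 2 : ℝ) • x + (1 / 2 : ℝ) • q - x = (1 / 2 : ℝ) • (q - x) := by module
  rw [h3, real_inner_smul_right] at h2
  rw [norm_sub_rev x q] at h1
  simp only [smul_eq_mul] at h1
  linarith

/-- The continuous selection is the smallest subgradient along directions pointing into `K`. -/
theorem IsRegularizer.inner_le_inner_selection [CompleteSpace E] (hreg : IsRegularizer K h dh)
    (hne : (interior K).Nonempty) {x g q : E} (hx : x ∈ K) (hg : g ∈ subdiff K h x) (hq : q ∈ K) :
    ⟪g, q - x⟫ ≤ ⟪dh x, q - x⟫ := by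
  obtain ⟨m, hm0, hm⟩ := hreg.strongConvexOn
  have hconv : ConvexOn ℝ K h := (hm.strictConvexOn hm0).convexOn
  have hdom := interior_subset_subdiffDomain hconv hreg.continuousOn
  have hint : ∀ z ∈ interior K, ⟪g, z - x⟫ ≤ ⟪dh x, z - x⟫ := by
    intro z hz
    -- Approach `x` along the segment towards an interior point: monotonicity compares `g` with `dh
    -- (ℓ t)`, and continuity of the selection passes to `t → 0`.
    let ℓ : ℝ → E := fun t => x + t • (z - x)
    have hℓint : ∀ t ∈ Ioc (0 : ℝ) 1, ℓ t ∈ interior K := fun t ht =>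
      hconv.1.add_smul_sub_mem_interior hx hz ht
    have hℓ : Tendsto ℓ (𝓝[>] 0) (𝓝[subdiffDomain K h] x) := by
      refine tendsto_nhdsWithin_iff.2 ⟨?_, ?_⟩
      · have h1 : Continuous ℓ := by fun_prop
        have h2 := h1.tendsto 0
        simp only [ℓ, zero_smul, add_zero] at h2
        exact h2.mono_left nhdsWithin_le_nhds
      · filter_upwards [Ioc_mem_nhdsGT one_pos] with t ht
        exact hdom (hℓint t ht)
    have hlim : Tendsto (fun t => ⟪dh (ℓ t), z - x⟫) (𝓝[>] 0) (𝓝 ⟪dh x, z - x⟫) :=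
      ((hreg.selection_continuousOn x ⟨hx, g, hg⟩).tendsto.comp hℓ).inner tendsto_const_nhds
    refine ge_of_tendsto hlim ?_
    filter_upwards [Ioc_mem_nhdsGT one_pos] with t ht
    have hmem := hdom (hℓint t ht)
    have h1 := monotone_subdiff hx hmem.1 hg (hreg.selection_mem _ hmem)
    have h2 : ℓ t - x = t • (z - x) := add_sub_cancel_left _ _
    rw [h2, real_inner_smul_right, inner_sub_left] at h1
    exact sub_nonneg.1 (nonneg_of_mul_nonneg_right h1 ht.1)
  have hclosed : IsClosed {z : E | ⟪g, z - x⟫ ≤ ⟪dh x, z - x⟫} :=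
    isClosed_le (by fun_prop) (by fun_prop)
  have h1 : q ∈ closure (interior K) := by
    rw [hconv.1.closure_interior_eq_closure_of_nonempty_interior hne]
    exact subset_closure hq
  exact hclosed.closure_subset_iff.2 hint h1

/-- Up to a constant, the prox objective at `x'` is `h x' - ⟪y + dh x, x'⟫`, so minimality is the
subgradient inequality. -/
theorem IsProx.mem_subdiff {x y xnew : E} (hp : IsProx K h dh x y xnew) :
    y + dh x ∈ subdiff K h xnew := by
  intro q hq
  have h1 := hp.2 hq
  simp only [bregman, mem_ofPred_eq] at h1
  have h2 : ⟪y + dh x, q - xnew⟫ = ⟪y, x - xnew⟫ - ⟪y, x - q⟫ + ⟪dh x, q - x⟫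
      - ⟪dh x, xnew - x⟫ := by
    simp only [inner_add_left, inner_sub_right]
    ring
  linarith

theorem IsProx.mem_subdiffDomain {x y xnew : E} (hp : IsProx K h dh x y xnew) :
    xnew ∈ subdiffDomain K h :=
  ⟨hp.1, _, hp.mem_subdiff⟩

theorem IsRegularizer.sq_le_bregman (hreg : IsRegularizer K h dh) :
    ∃ m : ℝ, 0 < m ∧ ∀ x ∈ subdiffDomain K h, ∀ q ∈ K, m * ‖q - x‖ ^ 2 ≤ bregman h dh q x := by
  obtain ⟨m, hm0, hm⟩ := hreg.strongConvexOn
  refine ⟨m / 4, by positivity, fun x hx q hq => ?_⟩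
  have h1 := hm.add_inner_add_sq_le hx.1 hq (hreg.selection_mem x hx)
  rw [bregman]
  linarith

/-- One step of mirror descent: the variation of the Bregman divergence to a fixed point. -/
theorem IsRegularizer.exists_bregman_prox_le [CompleteSpace E] (hreg : IsRegularizer K h dh)
    (hne : (interior K).Nonempty) :
    ∃ C : ℝ, 0 ≤ C ∧ ∀ x ∈ subdiffDomain K h, ∀ q ∈ K, ∀ y xnew, IsProx K h dh x y xnew →
      bregman h dh q xnew ≤ bregman h dh q x + ⟪y, x - q⟫ + C * ‖y‖ ^ 2 := by
  obtain ⟨m, hm0, hm⟩ := hreg.sq_le_bregman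
  -- Young's inequality with this constant absorbs the displacement `xnew - x` into the divergence
  -- from `x` to `xnew`.
  refine ⟨(4 * m)⁻¹, by positivity, fun x hx q hq y xnew hp => ?_⟩
  -- The prox condition provides `y + dh x` as a subgradient at `xnew`, which may differ from `dh
  -- xnew`; the comparison goes in the direction needed.
  have h1 := hreg.inner_le_inner_selection hne hp.1 hp.mem_subdiff hq
  have h2 := hm x hx xnew hp.1
  have h3 : ⟪y, xnew - x⟫ ≤ m * ‖xnew - x‖ ^ 2 + (4 * m)⁻¹ * ‖y‖ ^ 2 := by
    refine (real_inner_le_norm _ _).trans ?_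
    have h4 : m * ‖xnew - x‖ ^ 2 + (4 * m)⁻¹ * ‖y‖ ^ 2 - ‖y‖ * ‖xnew - x‖ =
        m * (‖xnew - x‖ - (2 * m)⁻¹ * ‖y‖) ^ 2 := by
      field_simp
      ring
    have h5 : 0 ≤ m * (‖xnew - x‖ - (2 * m)⁻¹ * ‖y‖) ^ 2 := by positivity
    linarith
  have h6 : ⟪y + dh x, q - xnew⟫ = -⟪y, x - q⟫ - ⟪y, xnew - x⟫ + ⟪dh x, q - x⟫
      - ⟪dh x, xnew - x⟫ := by
    simp only [inner_add_left, inner_sub_right]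
    ring
  simp only [bregman] at h2 ⊢
  linarith

/-- The point at which a given vector is a subgradient depends continuously on this vector. -/
theorem IsRegularizer.exists_continuous_inverse_subdiff (hreg : IsRegularizer K h dh)
    (hK : IsCompact K) (hne : K.Nonempty) :
    ∃ Q : E → E, Continuous Q ∧ ∀ a ∈ K, ∀ z ∈ subdiff K h a, a = Q z := by
  obtain ⟨m, hm0, hm⟩ := hreg.strongConvexOn
  have hex : ∀ z : E, ∃ a ∈ K, z ∈ subdiff K h a := fun z => by
    obtain ⟨a, ha, hmin⟩ := hK.exists_isMinOn hne (f := fun a => h a - ⟪z, a⟫)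
      (hreg.continuousOn.sub (Continuous.continuousOn (by fun_prop)))
    refine ⟨a, ha, fun q hq => ?_⟩
    have h1 := hmin hq
    simp only [mem_ofPred_eq] at h1
    rw [inner_sub_right]
    linarith
  -- The strong subgradient inequalities at `a` and `b`, added together, give both uniqueness and
  -- Lipschitz dependence.
  have hlip : ∀ a ∈ K, ∀ b ∈ K, ∀ z w, z ∈ subdiff K h a → w ∈ subdiff K h b →
      ‖a - b‖ ≤ 2 / m * ‖z - w‖ := by
    intro a ha b hb z w hz hw
    have h1 := hm.add_inner_add_sq_le ha hb hz
    have h2 := hm.add_inner_add_sq_le hb ha hw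
    have h3 : ⟪z, b - a⟫ + ⟪w, a - b⟫ = -⟪z - w, a - b⟫ := by
      simp only [inner_sub_left, inner_sub_right]
      ring
    have h4 := real_inner_le_norm (z - w) (a - b)
    rw [norm_sub_rev b a] at h1
    have h5 : m / 2 * ‖a - b‖ ^ 2 ≤ ‖z - w‖ * ‖a - b‖ := by linarith
    rw [div_mul_eq_mul_div, le_div_iff₀ hm0]
    rcases (norm_nonneg (a - b)).eq_or_lt with h0 | h0
    · rw [← h0, zero_mul]
      positivity
    · refine le_of_mul_le_mul_right ?_ h0
      linarith
  choose Q hQ hQz using hex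
  refine ⟨Q, (LipschitzWith.of_dist_le_mul (K := Real.toNNReal (2 / m)) fun z w => ?_).continuous,
    fun a ha z hz => ?_⟩
  · rw [dist_eq_norm, dist_eq_norm, Real.coe_toNNReal _ (by positivity)]
    exact hlip _ (hQ z) _ (hQ w) z w (hQz z) (hQz w)
  · have h1 := hlip a ha _ (hQ z) z z hz (hQz z)
    rw [sub_self, norm_zero, mul_zero] at h1
    exact sub_eq_zero.1 (norm_le_zero_iff.1 h1)

end Subdifferential

/-! ### Real sequences: almost-decreasing recursions. -/

section Deterministic

/-- A Robbins-Siegmund type lemma for real sequences. -/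
theorem exists_tendsto_of_le_sub_add {V a e : ℕ → ℝ} (hV : ∀ n, 0 ≤ V n) (ha : ∀ n, 0 ≤ a n)
    {s : ℝ} (he : Tendsto (fun n => ∑ k ∈ Finset.range n, e k) atTop (𝓝 s))
    (hstep : ∀ n, V (n + 1) ≤ V n - a n + e n) :
    Summable a ∧ ∃ l, Tendsto V atTop (𝓝 l) := by
  -- The errors are signed and their series need only converge, so they are subtracted as partial
  -- sums and not bounded in absolute value.
  have hdec : Antitone fun n => V n + ∑ k ∈ Finset.range n, a k - ∑ k ∈ Finset.range n, e k := by
    refine antitone_nat_of_succ_le fun n => ?_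
    rw [Finset.sum_range_succ, Finset.sum_range_succ]
    linarith [hstep n]
  obtain ⟨C, hC⟩ := he.bddAbove_range
  have hle : ∀ n, V n + ∑ k ∈ Finset.range n, a k ≤ V 0 + C := fun n => by
    have h1 := hdec (Nat.zero_le n)
    have h2 := hC ⟨n, rfl⟩
    simp only [Finset.range_zero, Finset.sum_empty] at h1 h2
    linarith
  have hsum : Summable a := summable_of_sum_range_le ha fun n =>
    (by linarith [hle n, hV n] : ∑ k ∈ Finset.range n, a k ≤ V 0 + C)
  obtain ⟨B, hB⟩ := he.bddAbove_range
  have hbelow : BddBelow (range fun n =>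
      V n + ∑ k ∈ Finset.range n, a k - ∑ k ∈ Finset.range n, e k) := by
    refine ⟨-B, ?_⟩
    rintro _ ⟨n, rfl⟩
    have h2 := hB ⟨n, rfl⟩
    simp only at h2
    linarith [hV n, Finset.sum_nonneg fun k (_ : k ∈ Finset.range n) => ha k]
  have hlim := tendsto_atTop_ciInf hdec hbelow
  refine ⟨hsum, _, ((hlim.sub hsum.hasSum.tendsto_sum_nat).add he).congr fun n => ?_⟩
  ring

/-- Otherwise `γ n` is eventually at most `ε⁻¹ * (γ n * ψ n)`, hence summable. -/
theorem frequently_lt_of_summable_mul {γ ψ : ℕ → ℝ} (hγ : ∀ n, 0 < γ n)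
    (hγ_sum : Tendsto (fun n => ∑ k ∈ Finset.range n, γ k) atTop atTop)
    (hsum : Summable fun n => γ n * ψ n) {ε : ℝ} (hε : 0 < ε) : ∃ᶠ n in atTop, ψ n < ε := by
  intro h
  simp only [not_lt] at h
  have h2 : Summable γ := by
    refine Summable.of_norm_bounded_eventually_nat (g := fun n => ε⁻¹ * (γ n * ψ n))
      (hsum.mul_left _) ?_
    filter_upwards [h] with n hn
    rw [Real.norm_of_nonneg (hγ n).le, inv_mul_eq_div, le_div_iff₀ hε]
    exact mul_le_mul_of_nonneg_left hn (hγ n).le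
  exact not_tendsto_nhds_of_tendsto_atTop hγ_sum _ h2.hasSum.tendsto_sum_nat

end Deterministic

/-! ### Almost sure convergence of series of martingale differences. -/

section MartingaleDifferences

variable {Ω : Type*}

/-- If `Z` is independent of `m`, and `Φ`, `X` are `m`-measurable, then `Φ` is orthogonal to
`F (X, Z)` as soon as `F (x, ·)` is centered for the law of `Z`. -/
theorem integral_mul_comp_eq_zero {m mΩ : MeasurableSpace Ω} {P : Measure Ω}
    [IsProbabilityMeasure P] (hm : m ≤ mΩ) {E S : Type*} [MeasurableSpace E] [MeasurableSpace S] {X : Ω → E} {Z : Ω → S} {Φ : Ω → ℝ}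
    (hX : Measurable[m] X) (hΦ : Measurable[m] Φ) (hZ : Measurable Z)
    (hind : Indep m (MeasurableSpace.comap Z inferInstance) P)
    {F : E × S → ℝ} (hF : Measurable F) (hF0 : ∀ x, ∫ z, F (x, z) ∂(P.map Z) = 0)
    (hint : Integrable (fun ω => Φ ω * F (X ω, Z ω)) P) :
    ∫ ω, Φ ω * F (X ω, Z ω) ∂P = 0 := by
  have hW : Measurable[m] fun ω => (Φ ω, X ω) := hΦ.prodMk hX
  have hW' : Measurable fun ω => (Φ ω, X ω) := hW.mono hm le_rfl
  have hWZ : IndepFun (fun ω => (Φ ω, X ω)) Z P := by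
    rw [IndepFun_iff_Indep]
    exact indep_of_indep_of_le_left hind hW.comap_le
  -- `Φ` and `X` jointly are independent of `Z`; under the product law, Fubini integrates `Z` first.
  have hmap := (indepFun_iff_map_prod_eq_prod_map_map hW'.aemeasurable hZ.aemeasurable).1 hWZ
  have hH : Measurable fun q : (ℝ × E) × S => q.1.1 * F (q.1.2, q.2) := by fun_prop
  have h1 : ∫ ω, Φ ω * F (X ω, Z ω) ∂P =
      ∫ q, q.1.1 * F (q.1.2, q.2) ∂(P.map fun ω => ((Φ ω, X ω), Z ω)) :=
    (integral_map (hW'.prodMk hZ).aemeasurable hH.aestronglyMeasurable).symm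
  have := Measure.isProbabilityMeasure_map (μ := P) hZ.aemeasurable
  have := Measure.isProbabilityMeasure_map (μ := P) hW'.aemeasurable
  have hint' : Integrable (fun q : (ℝ × E) × S => q.1.1 * F (q.1.2, q.2))
      ((P.map fun ω => (Φ ω, X ω)).prod (P.map Z)) := by
    rw [← hmap]
    exact (integrable_map_measure hH.aestronglyMeasurable (hW'.prodMk hZ).aemeasurable).2 hint
  rw [h1, hmap, integral_prod _ hint']
  simp [integral_const_mul, hF0]

/-- A series of bounded martingale differences with square-summable bounds converges almost
surely. The martingale property is expressed by orthogonality to the past. -/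
theorem ae_tendsto_sum_of_orthogonal {mΩ : MeasurableSpace Ω} {P : Measure Ω}
    [IsProbabilityMeasure P] (ℱ : Filtration ℕ mΩ)
    {η : ℕ → Ω → ℝ} {c : ℕ → ℝ} (hη : ∀ n, Measurable[ℱ (n + 1)] (η n))
    (hbdd : ∀ n ω, |η n ω| ≤ c n) (hc : Summable fun n => c n ^ 2)
    (horth : ∀ n (Φ : Ω → ℝ), Measurable[ℱ n] Φ → (∃ C, ∀ ω, |Φ ω| ≤ C) →
      ∫ ω, Φ ω * η n ω ∂P = 0) :
    ∀ᵐ ω ∂P, ∃ s, Tendsto (fun n => ∑ k ∈ Finset.range n, η k ω) atTop (𝓝 s) := by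
  let M : ℕ → Ω → ℝ := fun n ω => ∑ k ∈ Finset.range n, η k ω
  have hMmeas : ∀ n, Measurable[ℱ n] (M n) := fun n =>
    Finset.measurable_fun_sum _ fun k hk =>
      (hη k).mono (ℱ.mono (Nat.succ_le_of_lt (Finset.mem_range.1 hk))) le_rfl
  have hMmeas' : ∀ n, Measurable (M n) := fun n => (hMmeas n).mono (ℱ.le n) le_rfl
  have hηmeas' : ∀ n, Measurable (η n) := fun n => (hη n).mono (ℱ.le _) le_rfl
  have hMbdd : ∀ n ω, |M n ω| ≤ ∑ k ∈ Finset.range n, c k := fun n ω =>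
    (Finset.abs_sum_le_sum_abs _ _).trans (Finset.sum_le_sum fun k _ => hbdd k ω)
  have bint : ∀ {f : Ω → ℝ} (C : ℝ), Measurable f → (∀ ω, |f ω| ≤ C) → Integrable f P :=
    fun C hf h => Integrable.of_bound hf.aestronglyMeasurable C (Eventually.of_forall h)
  have hMint : ∀ n, Integrable (M n) P := fun n => bint _ (hMmeas' n) (hMbdd n)
  have hηint : ∀ n, Integrable (η n) P := fun n => bint _ (hηmeas' n) (hbdd n)
  have hMint2 : ∀ n, Integrable (fun ω => M n ω ^ 2) P := fun n =>
    bint ((∑ k ∈ Finset.range n, c k) ^ 2) ((hMmeas' n).pow_const 2) fun ω => by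
      rw [abs_pow]
      exact pow_le_pow_left₀ (abs_nonneg _) (hMbdd n ω) 2
  have hηint2 : ∀ n, Integrable (fun ω => η n ω ^ 2) P := fun n =>
    bint (c n ^ 2) ((hηmeas' n).pow_const 2) fun ω => by
      rw [abs_pow]
      exact pow_le_pow_left₀ (abs_nonneg _) (hbdd n ω) 2
  have hMηint : ∀ n, Integrable (fun ω => M n ω * η n ω) P := fun n =>
    bint ((∑ k ∈ Finset.range n, c k) * c n) ((hMmeas' n).mul (hηmeas' n)) fun ω => by
      rw [abs_mul]
      exact mul_le_mul (hMbdd n ω) (hbdd n ω) (abs_nonneg _) ((abs_nonneg _).trans (hMbdd n ω))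
  -- Orthogonality applied to `M n` itself, which is bounded, removes the cross term.
  have hL2 : ∀ n, ∫ ω, M n ω ^ 2 ∂P ≤ ∑ k ∈ Finset.range n, c k ^ 2 := by
    intro n
    induction n with
    | zero => simp [M]
    | succ n ih =>
      have h1 : ∀ ω, M (n + 1) ω ^ 2 = M n ω ^ 2 + 2 * (M n ω * η n ω) + η n ω ^ 2 := fun ω => by
        simp only [M, Finset.sum_range_succ]
        ring
      have h2 : ∫ ω, η n ω ^ 2 ∂P ≤ c n ^ 2 := by
        calc ∫ ω, η n ω ^ 2 ∂P ≤ ∫ _, c n ^ 2 ∂P :=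
              integral_mono (hηint2 n) (integrable_const _) fun ω => by
                rw [← sq_abs]
                exact pow_le_pow_left₀ (abs_nonneg _) (hbdd n ω) 2
          _ = c n ^ 2 := by simp
      simp only [h1]
      have h3 := horth n (M n) (hMmeas n) ⟨_, hMbdd n⟩
      have h4 : Integrable (fun ω => M n ω ^ 2 + 2 * (M n ω * η n ω)) P :=
        (hMint2 n).add ((hMηint n).const_mul 2)
      rw [integral_add h4 (hηint2 n), integral_add (hMint2 n) ((hMηint n).const_mul 2), integral_const_mul, h3,
        Finset.sum_range_succ]
      linarith
  have hmart : Martingale M ℱ P := by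
    refine martingale_of_setIntegral_eq_succ (fun n => (hMmeas n).stronglyMeasurable) hMint ?_
    intro n s hs
    have h1 : ∀ ω, M (n + 1) ω = M n ω + η n ω := fun ω => by
      simp only [M, Finset.sum_range_succ]
    simp only [h1]
    rw [integral_add (hMint n).integrableOn (hηint n).integrableOn]
    have h2 := horth n (s.indicator 1) 
      ((measurable_const (a := (1 : ℝ))).indicator hs)
      ⟨1, fun ω => by by_cases h : ω ∈ s <;> simp [h]⟩
    have h3 : ∫ ω in s, η n ω ∂P = 0 := by
      rw [← h2, ← integral_indicator (ℱ.le n s hs)]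
      refine integral_congr_ae (Eventually.of_forall fun ω => ?_)
      by_cases h : ω ∈ s <;> simp [h]
    rw [h3, add_zero]
  -- Since `|M| ≤ 1 + M ^ 2`, the second-moment bound supplies the `L¹` bound required by the
  -- martingale convergence theorem.
  let R : NNReal := ⟨1 + ∑' k, c k ^ 2, by positivity⟩
  refine hmart.submartingale.exists_ae_tendsto_of_bdd (R := R) fun n => ?_
  rw [eLpNorm_one_eq_lintegral_enorm, ← ofReal_integral_norm_eq_lintegral_enorm (hMint n)]
  refine ENNReal.ofReal_le_of_le_toReal ?_
  change ∫ ω, ‖M n ω‖ ∂P ≤ 1 + ∑' k, c k ^ 2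
  calc ∫ ω, ‖M n ω‖ ∂P ≤ ∫ ω, (1 + M n ω ^ 2) ∂P :=
        integral_mono (hMint n).norm ((integrable_const _).add (hMint2 n)) fun ω => by
          rw [Real.norm_eq_abs, ← sq_abs]
          nlinarith [sq_nonneg (|M n ω| - 1), abs_nonneg (M n ω)]
    _ = 1 + ∫ ω, M n ω ^ 2 ∂P := by
        rw [integral_add (integrable_const _) (hMint2 n)]
        simp
    _ ≤ 1 + ∑' k, c k ^ 2 := by
        gcongr
        exact (hL2 n).trans (hc.sum_le_tsum _ fun k _ => sq_nonneg _)

end MartingaleDifferences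

/-! ### Adjoining the initial point to the independent family of directions. -/

section Independence

variable {Ω : Type*} [mΩ : MeasurableSpace Ω] {P : Measure Ω}

/-- The family of `σ`-algebras generated by `X` and by the members of the family `Z`. -/
@[reducible]
def optionComap {κ : Type*} {α : Type*} {β : κ → Type*} [MeasurableSpace α]
    [∀ q, MeasurableSpace (β q)] (X : Ω → α) (Z : ∀ q, Ω → β q) (o : Option κ) :
    MeasurableSpace Ω :=
  o.elim (MeasurableSpace.comap X inferInstance) fun q => MeasurableSpace.comap (Z q) inferInstance

/-- The index `none` carries `X`. Its independence of the whole family splits off one factor, and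
mutual independence of the `Z q` factorizes the rest. -/
theorem iIndep_optionComap {κ : Type*} {α : Type*} {β : κ → Type*} [MeasurableSpace α]
    [∀ q, MeasurableSpace (β q)] {X : Ω → α} {Z : ∀ q, Ω → β q}
    (hZ : iIndepFun Z P) (hX : IndepFun X (fun ω q => Z q ω) P) :
    iIndep (optionComap X Z) P := by
  classical
  have := hZ.isProbabilityMeasure
  rw [iIndep_iff]
  intro s f hf
  obtain ⟨g, hg, hgm⟩ : ∃ g : Option κ → Set Ω, (∀ o ∈ s, g o = f o) ∧ (none ∉ s → g none = univ) :=
    ⟨fun o => if o ∈ s then f o else univ, fun o ho => by simp [ho], fun h => by simp [h]⟩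
  have hnone : MeasurableSet[MeasurableSpace.comap X inferInstance] (g none) := by
    by_cases h : none ∈ s
    · rw [hg _ h]
      exact hf _ h
    · rw [hgm h]
      exact MeasurableSet.univ
  have hsome : ∀ q ∈ s.eraseNone, MeasurableSet[MeasurableSpace.comap (Z q) inferInstance]
      (g (some q)) := fun q hq => by
    rw [Finset.mem_eraseNone] at hq
    rw [hg _ hq]
    exact hf _ hq
  have h1 : ⋂ o ∈ s, f o = g none ∩ ⋂ q ∈ s.eraseNone, g (some q) := by
    ext ω
    simp only [mem_iInter, mem_inter_iff, Finset.mem_eraseNone]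
    constructor
    · intro h
      refine ⟨?_, fun q hq => hg _ hq ▸ h _ hq⟩
      by_cases hn : none ∈ s
      · exact hg _ hn ▸ h _ hn
      · rw [hgm hn]
        trivial
    · rintro ⟨h0, h⟩ (_ | q) ho
      · exact hg _ ho ▸ h0
      · exact hg _ ho ▸ h q ho
  have h2 : ∏ o ∈ s, P (f o) = P (g none) * ∏ q ∈ s.eraseNone, P (g (some q)) := by
    rw [← Finset.prod_insertNone (fun o => P (g o)) s.eraseNone, Finset.insertNone_eraseNone]
    by_cases hn : none ∈ s
    · rw [Finset.insert_eq_of_mem hn]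
      exact Finset.prod_congr rfl fun o ho => by rw [hg _ ho]
    · rw [Finset.prod_insert hn, hgm hn, measure_univ, one_mul]
      exact Finset.prod_congr rfl fun o ho => by rw [hg _ ho]
  rw [h1, h2, ← (iIndep_iff _ _).1 hZ.iIndep s.eraseNone hsome]
  refine (Indep_iff _ _ _).1 ((IndepFun_iff_Indep _ _ _).1 hX) _ _ hnone ?_
  refine Finset.measurableSet_biInter _ fun q hq => ?_
  refine (MeasurableSpace.comap_le_iff_le_map.2 ?_ : MeasurableSpace.comap (Z q) inferInstance ≤
    MeasurableSpace.comap (fun ω q => Z q ω) inferInstance) _ (hsome q hq)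
  intro t ht
  exact ⟨(fun z => z q) ⁻¹' t, measurable_pi_apply q ht, rfl⟩

end Independence

/-! ### Payoff expansions and equilibria of monotone games. -/

namespace ConcaveGame

variable {ι : Type*} [Fintype ι] [DecidableEq ι] {d : ι → ℕ} {G : ConcaveGame ι d}

theorem update_mem_actionSpace {x : Profile d} (hx : x ∈ G.actionSpace) {i : ι}
    {y : EuclideanSpace ℝ (Fin (d i))} (hy : y ∈ G.act i) :
    Function.update x i y ∈ G.actionSpace := by
  intro j _
  rcases eq_or_ne j i with rfl | hj
  · simpa using hy
  · simpa [hj] using hx j trivial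

theorem isCompact_actionSpace (G : ConcaveGame ι d) : IsCompact G.actionSpace :=
  isCompact_univ_pi G.isCompact_act

theorem HasLipschitzGradients.payoff_le (hlip : G.HasLipschitzGradients) {i : ι} {x : Profile d}
    (hx : x ∈ G.actionSpace) {y : EuclideanSpace ℝ (Fin (d i))} (hy : y ∈ G.act i) :
    G.payoff i (Function.update x i y) ≤ G.payoff i x + ⟪G.payoffGrad i x, y - x i⟫ := by
  have h := (G.concave_payoff i x hx).le_add_inner_gradientWithin (hx i trivial) hy
    ((hlip i).1 x hx)
  rwa [Function.update_eq_self] at h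

/-- First-order expansion of the payoff of a player in their own action. -/
theorem HasLipschitzGradients.exists_abs_payoff_sub_le (hlip : G.HasLipschitzGradients) (i : ι) :
    ∃ L : ℝ, 0 ≤ L ∧ ∀ x ∈ G.actionSpace, ∀ y ∈ G.act i,
      |G.payoff i (Function.update x i y) - G.payoff i x - ⟪G.payoffGrad i x, y - x i⟫| ≤
        L * ‖y - x i‖ ^ 2 := by
  obtain ⟨L, hL⟩ := (hlip i).2
  refine ⟨L, L.2, fun x hx y hy => ?_⟩
  have hx' := update_mem_actionSpace hx hy
  -- Tangent inequalities at both endpoints sandwich the error between zero and a variation of the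
  -- gradient.
  have h1 := hlip.payoff_le hx hy
  have h2 := hlip.payoff_le hx' (hx i trivial)
  rw [Function.update_idem, Function.update_eq_self, Function.update_self] at h2
  have h3 : ‖G.payoffGrad i (Function.update x i y) - G.payoffGrad i x‖ ≤ L * ‖y - x i‖ := by
    rw [← dist_eq_norm, ← dist_eq_norm]
    refine (hL.dist_le_mul _ hx' _ hx).trans (mul_le_mul_of_nonneg_left ?_ L.2)
    refine (dist_pi_le_iff dist_nonneg).2 fun j => ?_
    rcases eq_or_ne j i with rfl | hj
    · simp
    · simp [hj]
  have h4 := neg_le_of_abs_le (abs_real_inner_le_norm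
    (G.payoffGrad i (Function.update x i y) - G.payoffGrad i x) (y - x i))
  have h5 : ‖G.payoffGrad i (Function.update x i y) - G.payoffGrad i x‖ * ‖y - x i‖ ≤
      L * ‖y - x i‖ ^ 2 := by
    rw [sq, ← mul_assoc]
    exact mul_le_mul_of_nonneg_right h3 (norm_nonneg _)
  have h6 : 0 ≤ (L : ℝ) * ‖y - x i‖ ^ 2 := by positivity
  rw [inner_sub_left] at h4
  rw [← neg_sub y (x i), inner_neg_right] at h2
  rw [abs_le]
  constructor <;> linarith

/-- Existence of a solution to the weighted variational inequality of a monotone game. -/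
theorem exists_variational_solution (hlip : G.HasLipschitzGradients) {w : ι → ℝ}
    (hmono : ∀ x ∈ G.actionSpace, ∀ x' ∈ G.actionSpace, x ≠ x' →
      ∑ i, w i * ⟪G.payoffGrad i x' - G.payoffGrad i x, x' i - x i⟫ < 0)
    (hne : G.actionSpace.Nonempty) :
    ∃ x ∈ G.actionSpace, ∀ y ∈ G.actionSpace, ∑ i, w i * ⟪G.payoffGrad i x, y i - x i⟫ ≤ 0 := by
  -- The product is moved to its Euclidean version `PiLp 2` to have an inner product; the weights
  -- are absorbed into the field `F`.
  let K : Set (PiLp 2 fun i => EuclideanSpace ℝ (Fin (d i))) := WithLp.ofLp ⁻¹' G.actionSpace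
  let F : PiLp 2 (fun i => EuclideanSpace ℝ (Fin (d i))) →
      PiLp 2 fun i => EuclideanSpace ℝ (Fin (d i)) :=
    fun x => WithLp.toLp 2 fun i => w i • G.payoffGrad i (WithLp.ofLp x)
  have hKne : K.Nonempty := hne.preimage (WithLp.ofLp_surjective 2)
  have hK : IsCompact K := by
    have h1 : K = WithLp.toLp 2 '' G.actionSpace := by
      ext x
      exact ⟨fun hx => ⟨_, hx, rfl⟩, by rintro ⟨y, hy, rfl⟩; exact hy⟩
    rw [h1]
    exact G.isCompact_actionSpace.image (PiLp.continuous_toLp 2 _)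
  have hconv : Convex ℝ K := (convex_pi fun i _ => G.convex_act i).linear_preimage
    (WithLp.linearEquiv 2 ℝ (∀ i, EuclideanSpace ℝ (Fin (d i)))).toLinearMap
  have hinner : ∀ x y : PiLp 2 fun i => EuclideanSpace ℝ (Fin (d i)),
      ∀ g : ∀ i, EuclideanSpace ℝ (Fin (d i)),
      ⟪WithLp.toLp 2 (fun i => w i • g i), x - y⟫ = ∑ i, w i * ⟪g i, x i - y i⟫ := fun x y g => by
    rw [PiLp.inner_apply]
    exact Finset.sum_congr rfl fun i _ => real_inner_smul_left _ _ _
  choose L hL using fun i => (hlip i).2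
  have hLip : LipschitzOnWith (∑ i, ‖w i‖₊ * L i)
      (fun x : Profile d => fun i => w i • G.payoffGrad i x) G.actionSpace := by
    refine LipschitzOnWith.of_dist_le_mul fun x hx y hy => ?_
    refine (dist_pi_le_iff (by positivity)).2 fun i => ?_
    rw [dist_smul₀]
    calc ‖w i‖ * dist (G.payoffGrad i x) (G.payoffGrad i y) ≤ ‖w i‖ * (L i * dist x y) :=
          mul_le_mul_of_nonneg_left ((hL i).dist_le_mul _ hx _ hy) (norm_nonneg _)
      _ = ((‖w i‖₊ * L i : NNReal) : ℝ) * dist x y := by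
          rw [NNReal.coe_mul, coe_nnnorm, mul_assoc]
      _ ≤ _ := mul_le_mul_of_nonneg_right (NNReal.coe_le_coe.2
          (Finset.single_le_sum (f := fun i => ‖w i‖₊ * L i) (fun _ _ => zero_le)
            (Finset.mem_univ i))) dist_nonneg
  have hF := (PiLp.lipschitzWith_toLp 2 (fun i => EuclideanSpace ℝ (Fin (d i)))).comp_lipschitzOnWith
    (hLip.comp (PiLp.lipschitzWith_ofLp 2 (fun i => EuclideanSpace ℝ (Fin (d i)))).lipschitzOnWith
      (fun x (hx : x ∈ K) => hx))
  obtain ⟨x, hx, hvar⟩ := _root_.exists_variational_solution hKne hK hconv (F := F)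
    (fun x hx y hy => by
      have h1 := hF.dist_le_mul _ hx _ hy
      rw [dist_eq_norm, dist_eq_norm] at h1
      exact h1)
    (fun x hx y hy => by
      rcases eq_or_ne x y with rfl | hxy
      · simp
      · have h1 : F x - F y = WithLp.toLp 2 fun i => w i •
            (G.payoffGrad i (WithLp.ofLp x) - G.payoffGrad i (WithLp.ofLp y)) := by
          ext1 i
          simp [F, smul_sub]
        rw [h1, hinner]
        exact (hmono _ hy _ hx fun h => hxy (WithLp.ofLp_injective 2 h.symm)).le)
  refine ⟨WithLp.ofLp x, hx, fun y hy => ?_⟩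
  have h1 := hvar (WithLp.toLp 2 y) hy
  rwa [hinner] at h1

/-- A unilateral deviation leaves one term of the sum; its weight is positive, and concavity bounds
the payoff gain by the pairing. -/
theorem isNash_of_variational (hlip : G.HasLipschitzGradients) {w : ι → ℝ} (hw : ∀ i, 0 < w i)
    {x : Profile d} (hx : x ∈ G.actionSpace)
    (hvar : ∀ y ∈ G.actionSpace, ∑ i, w i * ⟪G.payoffGrad i x, y i - x i⟫ ≤ 0) : G.IsNash x := by
  refine ⟨hx, fun i y hy => ?_⟩
  have h1 := hvar _ (update_mem_actionSpace hx hy)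
  rw [Finset.sum_eq_single i (fun j _ hj => by simp [hj]) (by simp), Function.update_self] at h1
  linarith [hlip.payoff_le hx hy, nonpos_of_mul_nonpos_right h1 (hw i)]

end ConcaveGame

/-! ### Feasibility, size and bias of the one-point gradient estimate. -/

theorem continuous_realizedAction {ι : Type*} {d : ι → ℕ} (p : Profile d) (r : ι → ℝ) (δ : ℝ) :
    Continuous fun q : Profile d × (∀ i, UnitSphere (d i)) => realizedAction p r δ q.1 q.2 := by
  unfold realizedAction
  fun_prop

section Sampling

variable {ι : Type*} [Fintype ι] [DecidableEq ι] {d : ι → ℕ} {G : ConcaveGame ι d}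
  {p : Profile d} {r : ι → ℝ}

/-- Subtracting the feasibility adjustment and adding a vector of norm at most `δ` keeps an action
feasible. -/
theorem sub_add_smul_mem {E : Type*} [NormedAddCommGroup E] [NormedSpace ℝ E] {K : Set E}
    (hK : Convex ℝ K) {p x z : E} {r δ : ℝ} (hr : 0 < r) (hball : Metric.closedBall p r ⊆ K)
    (hδ : 0 ≤ δ) (hδr : δ ≤ r) (hx : x ∈ K) (hz : ‖z‖ ≤ 1) :
    x + δ • (z - r⁻¹ • (x - p)) ∈ K := by
  have h1 : p + r • z ∈ K := hball (by
    rw [mem_closedBall_iff_norm, add_sub_cancel_left, norm_smul, Real.norm_of_nonneg hr.le]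
    nlinarith)
  -- The new point is the average of `x` and `p + r • z` with weights `1 - δ / r` and `δ / r`.
  have h2 := hK hx h1 (a := 1 - δ / r) (b := δ / r) (sub_nonneg.2 ((div_le_one hr).2 hδr))
    (by positivity) (by ring)
  convert h2 using 1
  have h3 : (δ / r) • r • z = δ • z := by rw [smul_smul, div_mul_cancel₀ _ hr.ne']
  rw [smul_add, h3, div_eq_mul_inv]
  module

theorem realizedAction_mem (hr : ∀ i, 0 < r i)
    (hball : ∀ i, Metric.closedBall (p i) (r i) ⊆ G.act i) {δ : ℝ} (hδ : 0 ≤ δ)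
    (hδr : ∀ i, δ ≤ r i) {x : Profile d} (hx : x ∈ G.actionSpace) (z : ∀ i, UnitSphere (d i)) :
    realizedAction p r δ x z ∈ G.actionSpace := fun i _ =>
  sub_add_smul_mem (G.convex_act i) (hr i) (hball i) hδ (hδr i) (hx i trivial)
    (norm_eq_of_mem_sphere (z i)).le

theorem exists_norm_realizedAction_sub_le (G : ConcaveGame ι d) (p : Profile d) (r : ι → ℝ) :
    ∃ B : ℝ, 0 ≤ B ∧ ∀ δ : ℝ, 0 ≤ δ → ∀ x ∈ G.actionSpace, ∀ z : ∀ i, UnitSphere (d i),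
      (∀ i, ‖realizedAction p r δ x z i - x i‖ ≤ B * δ) ∧
      ∀ i, ‖δ • (r i)⁻¹ • (x i - p i)‖ ≤ B * δ := by
  have h1 : ∀ i, ∃ B : ℝ, ∀ y ∈ G.act i, ‖(r i)⁻¹ • (y - p i)‖ ≤ B := fun i =>
    (G.isCompact_act i).exists_bound_of_continuousOn (Continuous.continuousOn (by fun_prop))
  choose B hB using h1
  have h2 : ∀ i, 0 ≤ |B i| := fun i => abs_nonneg _
  have h3 : ∀ x ∈ G.actionSpace, ∀ i, ‖(r i)⁻¹ • (x i - p i)‖ ≤ ∑ j, |B j| := fun x hx i =>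
    (hB i _ (hx i trivial)).trans ((le_abs_self _).trans
      (Finset.single_le_sum (fun j _ => h2 j) (Finset.mem_univ i)))
  have h4 : 0 ≤ ∑ j, |B j| := Finset.sum_nonneg fun j _ => h2 j
  refine ⟨1 + ∑ j, |B j|, by positivity, fun δ hδ x hx z => ⟨fun i => ?_, fun i => ?_⟩⟩
  · rw [realizedAction, add_sub_cancel_left, norm_smul, Real.norm_of_nonneg hδ, mul_comm]
    refine mul_le_mul_of_nonneg_right ((norm_sub_le _ _).trans ?_) hδ
    rw [norm_eq_of_mem_sphere]
    linarith [h3 x hx i]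
  · rw [norm_smul, Real.norm_of_nonneg hδ, mul_comm]
    exact mul_le_mul_of_nonneg_right (by linarith [h3 x hx i]) hδ

theorem exists_norm_spsaEstimate_le (hbdd : G.HasBoundedMeasurablePayoffs) :
    ∃ C : ℝ, 0 ≤ C ∧ ∀ δ : ℝ, 0 < δ → ∀ x ∈ G.actionSpace, ∀ (z : ∀ i, UnitSphere (d i)) (i : ι),
      ‖spsaEstimate G δ x z i‖ ≤ C / δ := by
  choose C hC using fun i => (hbdd i).2
  have h2 : ∀ i, 0 ≤ d i * |C i| := fun i => by positivity
  refine ⟨∑ i, d i * |C i|, Finset.sum_nonneg fun i _ => h2 i, fun δ hδ x hx z i => ?_⟩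
  have h3 : d i * |C i| ≤ ∑ j, d j * |C j| :=
    Finset.single_le_sum (fun j _ => h2 j) (Finset.mem_univ i)
  rw [spsaEstimate, norm_smul, norm_eq_of_mem_sphere, mul_one, Real.norm_eq_abs, abs_mul,
    abs_of_nonneg (by positivity), div_mul_eq_mul_div]
  refine div_le_div_of_nonneg_right (le_trans ?_ h3) hδ.le
  exact mul_le_mul_of_nonneg_left ((hC i x hx).trans (le_abs_self _)) (Nat.cast_nonneg _)

/-- First-order expansion of the realized payoff along the direction sampled by a player. -/
theorem exists_abs_payoff_realizedAction_sub_le (hlip : G.HasLipschitzGradients)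
    (hr : ∀ i, 0 < r i) (hball : ∀ i, Metric.closedBall (p i) (r i) ⊆ G.act i) (i : ι) :
    ∃ C : ℝ, 0 ≤ C ∧ ∀ δ : ℝ, 0 < δ → (∀ j, δ ≤ r j) → ∀ x ∈ G.actionSpace,
      ∀ z : ∀ i, UnitSphere (d i),
      |G.payoff i (realizedAction p r δ x z) -
        G.payoff i (Function.update (realizedAction p r δ x z) i
          (x i - δ • (r i)⁻¹ • (x i - p i))) - δ * ⟪G.payoffGrad i x, (z i).1⟫| ≤ C * δ ^ 2 := by
  obtain ⟨L, hL0, hL⟩ := hlip.exists_abs_payoff_sub_le i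
  obtain ⟨L', hL'⟩ := (hlip i).2
  obtain ⟨B, hB0, hB⟩ := exists_norm_realizedAction_sub_le G p r
  refine ⟨L + L' * B, by positivity, fun δ hδ hδr x hx z => ?_⟩
  -- The base point `a` drops only player `i`'s own direction: it keeps the feasibility adjustment
  -- and the perturbations of the others, is `O(δ)` from `x`, and misses the realized action by `δ •
  -- z i`.
  obtain ⟨a, ha⟩ : ∃ a, a = Function.update (realizedAction p r δ x z) i
    (x i - δ • (r i)⁻¹ • (x i - p i)) := ⟨_, rfl⟩
  have hreal := realizedAction_mem hr hball hδ.le hδr hx z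
  have hai : a i = x i - δ • (r i)⁻¹ • (x i - p i) := by rw [ha, Function.update_self]
  have hbase : x i - δ • (r i)⁻¹ • (x i - p i) ∈ G.act i := by
    have h1 := sub_add_smul_mem (z := 0) (G.convex_act i) (hr i) (hball i) hδ.le (hδr i)
      (hx i trivial) (by simp)
    rwa [zero_sub, smul_neg, ← sub_eq_add_neg] at h1
  have hamem : a ∈ G.actionSpace := by
    rw [ha]
    exact ConcaveGame.update_mem_actionSpace hreal hbase
  have hupd : Function.update a i (realizedAction p r δ x z i) = realizedAction p r δ x z := by
    rw [ha, Function.update_idem, Function.update_eq_self]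
  have hdiff : realizedAction p r δ x z i - a i = δ • (z i).1 := by
    rw [hai, realizedAction]
    module
  have h1 := hL a hamem _ (hreal i trivial)
  rw [hupd, hdiff, norm_smul, norm_eq_of_mem_sphere, mul_one, Real.norm_of_nonneg hδ.le,
    real_inner_smul_right] at h1
  have h2 : ‖G.payoffGrad i a - G.payoffGrad i x‖ ≤ L' * (B * δ) := by
    rw [← dist_eq_norm]
    refine (hL'.dist_le_mul _ hamem _ hx).trans (mul_le_mul_of_nonneg_left ?_ L'.2)
    refine (dist_pi_le_iff (by positivity)).2 fun j => ?_
    rcases eq_or_ne j i with rfl | hj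
    · rw [hai, dist_eq_norm, sub_sub_cancel_left, norm_neg]
      exact (hB δ hδ.le x hx z).2 j
    · rw [ha, Function.update_of_ne hj, dist_eq_norm]
      exact (hB δ hδ.le x hx z).1 j
  have h3 : |δ * ⟪G.payoffGrad i a - G.payoffGrad i x, (z i).1⟫| ≤ δ * (L' * (B * δ)) := by
    rw [abs_mul, abs_of_pos hδ]
    refine mul_le_mul_of_nonneg_left ((abs_real_inner_le_norm _ _).trans ?_) hδ.le
    rw [norm_eq_of_mem_sphere, mul_one]
    exact h2
  rw [inner_sub_left] at h3
  rw [← ha]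
  rw [abs_le] at h1 h3 ⊢
  constructor <;> nlinarith

/-- Reversal of the direction sampled by one player. -/
def flipDirection (i : ι) (z : ∀ j, UnitSphere (d j)) : ∀ j, UnitSphere (d j) :=
  fun j => if j = i then sphereMap (LinearIsometryEquiv.neg ℝ) (z j) else z j

theorem measurePreserving_flipDirection (i : ι) :
    MeasurePreserving (flipDirection (d := d) i) (Measure.pi fun j => uniformSphere (d j))
      (Measure.pi fun j => uniformSphere (d j)) :=
  measurePreserving_pi (f := fun j z => if j = i then sphereMap (LinearIsometryEquiv.neg ℝ) z else z)
    _ _ fun j => by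
    by_cases hj : j = i
    · simpa only [hj, if_true] using measurePreserving_sphereMap _
    · simp only [hj, if_false]
      exact MeasurePreserving.id _

/-- The flip preserves the measure, so the integral equals its own negative. -/
theorem integral_eq_zero_of_flipDirection (i : ι) {f : (∀ j, UnitSphere (d j)) → ℝ}
    (hf : Measurable f) (hodd : ∀ z, f (flipDirection i z) = -f z) :
    ∫ z, f z ∂(Measure.pi fun j => uniformSphere (d j)) = 0 := by
  have h1 := measurePreserving_flipDirection (d := d) i
  have h2 := integral_map (μ := Measure.pi fun j => uniformSphere (d j)) h1.measurable.aemeasurable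
    (f := f) hf.aestronglyMeasurable
  rw [h1.map_eq] at h2
  simp only [hodd, integral_neg] at h2
  linarith

theorem measurable_payoff_comp (hbdd : G.HasBoundedMeasurablePayoffs) {α : Type*}
    {mα : MeasurableSpace α} {f : α → Profile d} (hf : Measurable f)
    (hmem : ∀ a, f a ∈ G.actionSpace) (i : ι) : Measurable fun a => G.payoff i (f a) :=
  (hbdd i).1.comp (hf.subtype_mk (h := hmem))

/-- Let `U` be the realized payoff and `A` the payoff with player `i`'s own direction removed. `A`
does not depend on `z i`, so it contributes zero by oddness. The difference `U - A` is linear in `z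
i` with gradient `payoffGrad i x`, up to `O(δ ^ 2)`; the second moment `1 / d i` cancels the factor
`d i`, and dividing by `δ` leaves a bias of order `δ`. -/
theorem exists_abs_integral_spsaEstimate_sub_le (hbdd : G.HasBoundedMeasurablePayoffs)
    (hlip : G.HasLipschitzGradients) (hr : ∀ i, 0 < r i)
    (hball : ∀ i, Metric.closedBall (p i) (r i) ⊆ G.act i) (hd : ∀ i, d i ≠ 0) (i : ι) :
    ∃ C : ℝ, 0 ≤ C ∧ ∀ δ : ℝ, 0 < δ → (∀ j, δ ≤ r j) → ∀ x ∈ G.actionSpace,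
      ∀ a : EuclideanSpace ℝ (Fin (d i)),
      |∫ z, ⟪spsaEstimate G δ (realizedAction p r δ x z) z i, a⟫
          ∂(Measure.pi fun j => uniformSphere (d j)) - ⟪G.payoffGrad i x, a⟫| ≤ C * δ * ‖a‖ := by
  have hprob : ∀ j, IsProbabilityMeasure (uniformSphere (d j)) := fun j =>
    isProbabilityMeasure_uniformSphere (hd j)
  obtain ⟨C, hC0, hC⟩ := exists_abs_payoff_realizedAction_sub_le hlip hr hball i
  obtain ⟨M, hM⟩ := (hbdd i).2
  refine ⟨d i * C, by positivity, fun δ hδ hδr x hx a => ?_⟩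
  obtain ⟨ν, hν⟩ : ∃ ν, ν = Measure.pi fun j => uniformSphere (d j) := ⟨_, rfl⟩
  have : IsProbabilityMeasure ν := by rw [hν]; infer_instance
  have hdir : Measurable fun z : ∀ j, UnitSphere (d j) => (z i).1 :=
    measurable_subtype_coe.comp (measurable_pi_apply i)
  have hdira : Measurable fun z : ∀ j, UnitSphere (d j) => ⟪(z i).1, a⟫ := by fun_prop
  let A : (∀ j, UnitSphere (d j)) → ℝ := fun z => G.payoff i (Function.update
    (realizedAction p r δ x z) i (x i - δ • (r i)⁻¹ • (x i - p i)))
  let U : (∀ j, UnitSphere (d j)) → ℝ := fun z => G.payoff i (realizedAction p r δ x z)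
  have hreal : Measurable fun z : ∀ j, UnitSphere (d j) => realizedAction p r δ x z :=
    ((continuous_realizedAction p r δ).comp (Continuous.prodMk_right x)).measurable
  have hrealmem := realizedAction_mem (d := d) hr hball hδ.le hδr hx
  have hbase : x i - δ • (r i)⁻¹ • (x i - p i) ∈ G.act i := by
    have h1 := sub_add_smul_mem (z := 0) (G.convex_act i) (hr i) (hball i) hδ.le (hδr i)
      (hx i trivial) (by simp)
    rwa [zero_sub, smul_neg, ← sub_eq_add_neg] at h1
  have hbasemem := fun z => ConcaveGame.update_mem_actionSpace (hrealmem z) hbase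
  have hU : Measurable U := measurable_payoff_comp hbdd hreal hrealmem i
  have hA : Measurable A := by
    refine measurable_payoff_comp hbdd ?_ hbasemem i
    refine measurable_pi_lambda _ fun j => ?_
    rcases eq_or_ne j i with rfl | hj
    · simp
    · simp only [Function.update_of_ne hj]
      exact (measurable_pi_apply j).comp hreal
  have hinner : ∀ z : ∀ j, UnitSphere (d j), |⟪(z i).1, a⟫| ≤ ‖a‖ := fun z => by
    have h1 := abs_real_inner_le_norm (z i).1 a
    rwa [norm_eq_of_mem_sphere, one_mul] at h1
  have hAint : ∫ z, A z * ⟪(z i).1, a⟫ ∂ν = 0 := by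
    rw [hν]
    refine integral_eq_zero_of_flipDirection i (hA.mul hdira) fun z => ?_
    have h1 : A (flipDirection i z) = A z := by
      refine congrArg (G.payoff i) (funext fun j => ?_)
      rcases eq_or_ne j i with rfl | hj
      · simp
      · simp [hj, realizedAction, flipDirection]
    have h2 : (flipDirection i z i).1 = -(z i).1 := by
      simp [flipDirection, sphereMap]
    rw [h1, h2, inner_neg_left, mul_neg]
  have hint1 : Integrable (fun z => A z * ⟪(z i).1, a⟫) ν :=
    Integrable.of_bound (hA.mul hdira).aestronglyMeasurable (M * ‖a‖)
      (Eventually.of_forall fun z => by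
        rw [norm_mul]
        exact mul_le_mul (hM _ (hbasemem z)) (hinner z) (norm_nonneg _)
          ((abs_nonneg _).trans (hM _ (hbasemem z))))
  have hint0 : Integrable (fun z => U z * ⟪(z i).1, a⟫) ν :=
    Integrable.of_bound (hU.mul hdira).aestronglyMeasurable (M * ‖a‖)
      (Eventually.of_forall fun z => by
        rw [norm_mul]
        exact mul_le_mul (hM _ (hrealmem z)) (hinner z) (norm_nonneg _)
          ((abs_nonneg _).trans (hM _ (hrealmem z))))
  have hmp : MeasurePreserving (Function.eval i) ν (uniformSphere (d i)) := by
    rw [hν]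
    exact measurePreserving_eval _ i
  have hcont : Continuous fun y : UnitSphere (d i) =>
      ⟪G.payoffGrad i x, y.1⟫ * ⟪y.1, a⟫ := by fun_prop
  have hint2 : Integrable (fun z => ⟪G.payoffGrad i x, (z i).1⟫ * ⟪(z i).1, a⟫) ν :=
    (hmp.integrable_comp hcont.aestronglyMeasurable).2
      (integrable_uniformSphere_of_continuous hcont)
  have hmom : d i * ∫ z, ⟪G.payoffGrad i x, (z i).1⟫ * ⟪(z i).1, a⟫ ∂ν =
      ⟪G.payoffGrad i x, a⟫ := by
    rw [← mul_integral_inner_mul_inner_uniformSphere, ← hmp.map_eq,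
      integral_map hmp.measurable.aemeasurable hcont.aestronglyMeasurable]
  have hrem : |∫ z, (U z - A z - δ * ⟪G.payoffGrad i x, (z i).1⟫) * ⟪(z i).1, a⟫ ∂ν| ≤
      C * δ ^ 2 * ‖a‖ := by
    have h1 := norm_integral_le_of_norm_le_const (μ := ν) (C := C * δ ^ 2 * ‖a‖)
      (f := fun z => (U z - A z - δ * ⟪G.payoffGrad i x, (z i).1⟫) * ⟪(z i).1, a⟫)
      (Eventually.of_forall fun z => by
        rw [norm_mul]
        exact mul_le_mul (hC δ hδ hδr x hx z) (hinner z) (norm_nonneg _) (by positivity))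
    simpa using h1
  have hsplit : ∫ z, (U z - A z - δ * ⟪G.payoffGrad i x, (z i).1⟫) * ⟪(z i).1, a⟫ ∂ν =
      ∫ z, U z * ⟪(z i).1, a⟫ ∂ν -
        δ * ∫ z, ⟪G.payoffGrad i x, (z i).1⟫ * ⟪(z i).1, a⟫ ∂ν := by
    have h1 : ∀ z : ∀ j, UnitSphere (d j),
        (U z - A z - δ * ⟪G.payoffGrad i x, (z i).1⟫) * ⟪(z i).1, a⟫ =
        U z * ⟪(z i).1, a⟫ - A z * ⟪(z i).1, a⟫ -
          δ * (⟪G.payoffGrad i x, (z i).1⟫ * ⟪(z i).1, a⟫) := fun z => by ring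
    simp only [h1]
    have h2 : Integrable (fun z => U z * ⟪(z i).1, a⟫ - A z * ⟪(z i).1, a⟫) ν := hint0.sub hint1
    rw [integral_sub h2 (hint2.const_mul δ), integral_sub hint0 hint1, hAint,
      integral_const_mul, sub_zero]
  have hspsa : ∀ z : ∀ j, UnitSphere (d j),
      ⟪spsaEstimate G δ (realizedAction p r δ x z) z i, a⟫ = d i / δ * (U z * ⟪(z i).1, a⟫) :=
    fun z => by
      rw [spsaEstimate, real_inner_smul_left, mul_assoc]
  rw [← hν]
  simp only [hspsa, integral_const_mul]
  rw [hsplit] at hrem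
  have hfin : d i / δ * ∫ z, U z * ⟪(z i).1, a⟫ ∂ν - ⟪G.payoffGrad i x, a⟫ =
      d i / δ * (∫ z, U z * ⟪(z i).1, a⟫ ∂ν -
        δ * ∫ z, ⟪G.payoffGrad i x, (z i).1⟫ * ⟪(z i).1, a⟫ ∂ν) := by
    rw [← hmom]
    field_simp
  rw [hfin, abs_mul, abs_of_nonneg (by positivity)]
  calc d i / δ * |∫ z, U z * ⟪(z i).1, a⟫ ∂ν -
        δ * ∫ z, ⟪G.payoffGrad i x, (z i).1⟫ * ⟪(z i).1, a⟫ ∂ν| ≤ d i / δ * (C * δ ^ 2 * ‖a‖) :=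
        mul_le_mul_of_nonneg_left hrem (by positivity)
    _ = d i * C * δ * ‖a‖ := by
        field_simp

end Sampling

/-! ### The filtration of the process and independence of the next directions. -/

section Past

variable {ι : Type*} {d : ι → ℕ}

/-- The past of the process before stage `n`: the initial point and the directions sampled at the
earlier stages. -/
def pastFiltration {Ω : Type*} [mΩ : MeasurableSpace Ω] {X₀ : Ω → Profile d}
    {Z : ℕ → ∀ i, Ω → UnitSphere (d i)} (hX₀ : Measurable X₀) (hZ : ∀ n i, Measurable (Z n i)) :
    Filtration ℕ mΩ where
  -- The condition is vacuous for `none`, so the initial point always belongs to the past;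
  -- directions of stage `n` are excluded.
  seq n := ⨆ o ∈ {o : Option (ℕ × ι) | ∀ k ∈ o, k.1 < n},
    optionComap X₀ (fun k : ℕ × ι => Z k.1 k.2) o
  mono' m n hmn := biSup_mono fun o ho k hk => (ho k hk).trans_le hmn
  le' n := iSup₂_le fun o _ => by
    cases o with
    | none => exact hX₀.comap_le
    | some k => exact (hZ k.1 k.2).comap_le

variable {Ω : Type*} [mΩ : MeasurableSpace Ω] {X₀ : Ω → Profile d}
    {Z : ℕ → ∀ i, Ω → UnitSphere (d i)} {hX₀ : Measurable X₀} {hZ : ∀ n i, Measurable (Z n i)}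

theorem measurable_init_pastFiltration (n : ℕ) : Measurable[pastFiltration hX₀ hZ n] X₀ :=
  (comap_measurable X₀).mono (le_iSup₂_of_le
    (f := fun o (_ : o ∈ {o : Option (ℕ × ι) | ∀ k ∈ o, k.1 < n}) =>
      optionComap X₀ (fun k : ℕ × ι => Z k.1 k.2) o) none (by simp) le_rfl) le_rfl

theorem measurable_direction_pastFiltration {k n : ℕ} (hk : k < n) :
    Measurable[pastFiltration hX₀ hZ n] fun ω i => Z k i ω := by
  refine @measurable_pi_lambda _ _ _ (pastFiltration hX₀ hZ n) _ _ fun i => ?_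
  exact (comap_measurable (Z k i)).mono (le_iSup₂_of_le
    (f := fun o (_ : o ∈ {o : Option (ℕ × ι) | ∀ k ∈ o, k.1 < n}) =>
      optionComap X₀ (fun k : ℕ × ι => Z k.1 k.2) o) (some (k, i)) (by simpa using hk) le_rfl) le_rfl

/-- The two `σ`-algebras come from disjoint blocks of indices of one independent family. -/
theorem indep_pastFiltration {P : Measure Ω} (hind : iIndepFun (fun (q : ℕ × ι) ω => Z q.1 q.2 ω) P)
    (hind₀ : IndepFun X₀ (fun ω (q : ℕ × ι) => Z q.1 q.2 ω) P) (n : ℕ) :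
    Indep (pastFiltration hX₀ hZ n)
      (MeasurableSpace.comap (fun ω i => Z n i ω) inferInstance) P := by
  have h1 := indep_iSup_of_disjoint (m := optionComap X₀ (fun k : ℕ × ι => Z k.1 k.2))
    (fun o => by
      cases o with
      | none => exact hX₀.comap_le
      | some k => exact (hZ k.1 k.2).comap_le)
    (iIndep_optionComap hind hind₀)
    (S := {o : Option (ℕ × ι) | ∀ k ∈ o, k.1 < n}) (T := {o | ∃ i, o = some (n, i)})
    (Set.disjoint_left.2 fun o ho ⟨i, hi⟩ => lt_irrefl n (ho (n, i) hi))
  refine indep_of_indep_of_le_right h1 ?_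
  rw [MeasurableSpace.comap_le_iff_le_map]
  change Measurable[⨆ o ∈ {o : Option (ℕ × ι) | ∃ i, o = some (n, i)},
    optionComap X₀ (fun k : ℕ × ι => Z k.1 k.2) o] fun ω i => Z n i ω
  refine @measurable_pi_lambda _ _ _ (⨆ o ∈ {o : Option (ℕ × ι) | ∃ i, o = some (n, i)},
    optionComap X₀ (fun k : ℕ × ι => Z k.1 k.2) o) _ _ fun i => ?_
  exact (comap_measurable (Z n i)).mono (le_iSup₂_of_le
    (f := fun o (_ : o ∈ {o : Option (ℕ × ι) | ∃ i, o = some (n, i)}) =>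
      optionComap X₀ (fun k : ℕ × ι => Z k.1 k.2) o) (some (n, i)) ⟨i, rfl⟩ le_rfl) le_rfl

theorem map_directions_eq_pi [Fintype ι] {Ω : Type*} [MeasurableSpace Ω] {P : Measure Ω}
    {Z : ℕ → ∀ i, Ω → UnitSphere (d i)} (hZ : ∀ n i, Measurable (Z n i))
    (hlaw : ∀ n i, P.map (Z n i) = uniformSphere (d i))
    (hind : iIndepFun (fun (q : ℕ × ι) ω => Z q.1 q.2 ω) P) (n : ℕ) :
    P.map (fun ω i => Z n i ω) = Measure.pi fun i => uniformSphere (d i) := by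
  have := hind.isProbabilityMeasure
  have h1 : iIndepFun (fun i ω => Z n i ω) P :=
    hind.precomp (g := fun i => (n, i)) fun i j hij => (Prod.ext_iff.1 hij).2
  rw [(iIndepFun_iff_map_fun_eq_pi_map fun i => (hZ n i).aemeasurable).1 h1]
  simp only [hlaw]

end Past

/-! ### The Lyapunov function and its link with convergence. -/

section Convergence

variable {ι : Type*} [Fintype ι] [DecidableEq ι] {d : ι → ℕ} {G : ConcaveGame ι d}
  {h : ∀ i, EuclideanSpace ℝ (Fin (d i)) → ℝ}
  {dh : ∀ i, EuclideanSpace ℝ (Fin (d i)) → EuclideanSpace ℝ (Fin (d i))}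

/-- The set of pivots, i.e. the product of the domains of subdifferentiability. -/
def pivotSet (G : ConcaveGame ι d) (h : ∀ i, EuclideanSpace ℝ (Fin (d i)) → ℝ) :
    Set (Profile d) :=
  {x | ∀ i, x i ∈ subdiffDomain (G.act i) (h i)}

theorem pivotSet_subset_actionSpace : pivotSet G h ⊆ G.actionSpace := fun _ hx i _ => (hx i).1

/-- The weighted sum of the Bregman divergences of the players. -/
def weightedBregman (w : ι → ℝ) (h : ∀ i, EuclideanSpace ℝ (Fin (d i)) → ℝ)
    (dh : ∀ i, EuclideanSpace ℝ (Fin (d i)) → EuclideanSpace ℝ (Fin (d i))) (q x : Profile d) : ℝ :=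
  ∑ i, w i * bregman (h i) (dh i) (q i) (x i)

theorem weightedBregman_nonneg {w : ι → ℝ} (hw : ∀ i, 0 < w i)
    (hreg : ∀ i, IsRegularizer (G.act i) (h i) (dh i)) {q x : Profile d} (hq : q ∈ G.actionSpace)
    (hx : x ∈ pivotSet G h) : 0 ≤ weightedBregman w h dh q x :=
  Finset.sum_nonneg fun i _ => mul_nonneg (hw i).le (by
    obtain ⟨m, hm, hle⟩ := (hreg i).sq_le_bregman
    exact (by positivity : 0 ≤ m * ‖q i - x i‖ ^ 2).trans (hle _ (hx i) _ (hq i trivial)))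

theorem tendsto_of_weightedBregman {w : ι → ℝ} (hw : ∀ i, 0 < w i)
    (hreg : ∀ i, IsRegularizer (G.act i) (h i) (dh i)) {q : Profile d} (hq : q ∈ G.actionSpace)
    {x : ℕ → Profile d} (hx : ∀ n, x n ∈ pivotSet G h)
    (hlim : Tendsto (fun n => weightedBregman w h dh q (x n)) atTop (𝓝 0)) :
    Tendsto x atTop (𝓝 q) := by
  refine tendsto_pi_nhds.2 fun i => ?_
  choose m hm hle using fun i => (hreg i).sq_le_bregman
  have hnonneg : ∀ n j, 0 ≤ w j * bregman (h j) (dh j) (q j) (x n j) := fun n j =>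
    mul_nonneg (hw j).le (le_trans (mul_nonneg (hm j).le (sq_nonneg _))
      (hle j _ (hx n j) _ (hq j trivial)))
  have h1 : ∀ n, ‖x n i - q i‖ ^ 2 ≤ (w i * m i)⁻¹ * weightedBregman w h dh q (x n) := fun n => by
    have h2 := Finset.single_le_sum (fun j _ => hnonneg n j) (Finset.mem_univ i)
    have h3 := mul_le_mul_of_nonneg_left (hle i _ (hx n i) _ (hq i trivial)) (hw i).le
    rw [le_inv_mul_iff₀ (mul_pos (hw i) (hm i)), norm_sub_rev, mul_assoc]
    exact h3.trans h2
  have h2 := hlim.const_mul (w i * m i)⁻¹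
  rw [mul_zero] at h2
  have h3 : Tendsto (fun n => ‖x n i - q i‖ ^ 2) atTop (𝓝 0) :=
    squeeze_zero (fun _ => sq_nonneg _) h1 h2
  have h4 := h3.sqrt
  simp only [Real.sqrt_sq (norm_nonneg _), Real.sqrt_zero] at h4
  exact tendsto_iff_norm_sub_tendsto_zero.2 h4

/-- Outside a neighbourhood of `q`, compactness bounds `ψ` below by a positive constant, so the
sequence returns to that neighbourhood infinitely often. Reciprocity makes the divergence small
there, hence its limit `l` is zero. -/
theorem tendsto_of_frequently_lt {w : ι → ℝ} (hw : ∀ i, 0 < w i)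
    (hreg : ∀ i, IsRegularizer (G.act i) (h i) (dh i)) {q : Profile d} (hq : q ∈ G.actionSpace)
    {ψ : Profile d → ℝ} (hψ : ContinuousOn ψ G.actionSpace)
    (hψpos : ∀ x ∈ G.actionSpace, x ≠ q → 0 < ψ x)
    {x : ℕ → Profile d} (hx : ∀ n, x n ∈ pivotSet G h) {l : ℝ}
    (hlim : Tendsto (fun n => weightedBregman w h dh q (x n)) atTop (𝓝 l))
    (hfreq : ∀ ε : ℝ, 0 < ε → ∃ᶠ n in atTop, ψ (x n) < ε) :
    Tendsto x atTop (𝓝 q) := by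
  have hrec : Tendsto (weightedBregman w h dh q) (𝓝[pivotSet G h] q) (𝓝 0) := by
    have h1 : Tendsto (weightedBregman w h dh q) (𝓝[pivotSet G h] q) (𝓝 (∑ i, w i * 0)) := by
      refine tendsto_finsetSum _ fun i _ => Tendsto.const_mul _ ?_
      refine ((hreg i).reciprocity (q i) (hq i trivial)).comp ?_
      exact tendsto_nhdsWithin_iff.2 ⟨((continuous_apply i).tendsto q).mono_left nhdsWithin_le_nhds,
        eventually_of_mem self_mem_nhdsWithin fun x hx => hx i⟩
    simpa using h1
  have hle : ∀ ε : ℝ, 0 < ε → l ≤ ε := fun ε hε => by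
    obtain ⟨U, hU, hqU, hUε⟩ := mem_nhdsWithin.1 (hrec.eventually_lt_const hε)
    obtain ⟨c, hc, hcψ⟩ := (G.isCompact_actionSpace.diff hU).exists_forall_le'
      (hψ.mono sdiff_subset) (a := 0) fun y hy => hψpos y hy.1 (by rintro rfl; exact hy.2 hqU)
    refine le_of_tendsto_of_frequently hlim ((hfreq c hc).mono fun n hn => ?_)
    have hmem : x n ∈ U := by
      by_contra hn'
      exact absurd (hcψ _ ⟨pivotSet_subset_actionSpace (hx n), hn'⟩) (not_le.2 hn)
    exact (hUε ⟨hmem, hx n⟩ : weightedBregman w h dh q (x n) < ε).le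
  have h0 : l = 0 := le_antisymm (le_of_forall_pos_le_add fun ε hε => by
    rw [zero_add]
    exact hle ε hε) (ge_of_tendsto hlim (Eventually.of_forall fun n =>
      weightedBregman_nonneg hw hreg hq (hx n)))
  rw [h0] at hlim
  exact tendsto_of_weightedBregman hw hreg hq hx hlim

/-- One step of multi-agent mirror descent: the variation of the weighted Bregman divergence. -/
theorem exists_weightedBregman_prox_le {w : ι → ℝ} (hw : ∀ i, 0 < w i)
    (hreg : ∀ i, IsRegularizer (G.act i) (h i) (dh i))
    (hne : ∀ i, (interior (G.act i)).Nonempty) {q : Profile d} (hq : q ∈ G.actionSpace) :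
    ∃ C : ℝ, 0 ≤ C ∧ ∀ x ∈ pivotSet G h, ∀ (y xnew : Profile d) (γ B : ℝ), 0 ≤ γ →
      (∀ i, IsProx (G.act i) (h i) (dh i) (x i) (γ • y i) (xnew i)) → (∀ i, ‖y i‖ ≤ B) →
      weightedBregman w h dh q xnew ≤ weightedBregman w h dh q x +
        γ * ∑ i, w i * ⟪y i, x i - q i⟫ + C * (γ * B) ^ 2 := by
  choose C hC0 hC using fun i => (hreg i).exists_bregman_prox_le (hne i)
  refine ⟨∑ i, w i * C i, Finset.sum_nonneg fun i _ => mul_nonneg (hw i).le (hC0 i),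
    fun x hx y xnew γ B hγ hp hB => ?_⟩
  rw [weightedBregman, weightedBregman, Finset.mul_sum, Finset.sum_mul, ← Finset.sum_add_distrib,
    ← Finset.sum_add_distrib]
  refine Finset.sum_le_sum fun i _ => ?_
  have h1 := hC i _ (hx i) _ (hq i trivial) _ _ (hp i)
  have h2 : ‖γ • y i‖ ^ 2 ≤ (γ * B) ^ 2 := by
    rw [norm_smul, Real.norm_of_nonneg hγ]
    exact pow_le_pow_left₀ (by positivity) (mul_le_mul_of_nonneg_left (hB i) hγ) 2
  have h3 := h1.trans (add_le_add_right (mul_le_mul_of_nonneg_left h2 (hC0 i)) _)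
  rw [real_inner_smul_left] at h3
  calc _ ≤ w i * _ := mul_le_mul_of_nonneg_left h3 (hw i).le
    _ = _ := by ring

theorem measurable_spsaEstimate {p : Profile d} {r : ι → ℝ} (hbdd : G.HasBoundedMeasurablePayoffs)
    (hr : ∀ i, 0 < r i) (hball : ∀ i, Metric.closedBall (p i) (r i) ⊆ G.act i) {δ : ℝ}
    (hδ : 0 ≤ δ) (hδr : ∀ j, δ ≤ r j) {S : Set (Profile d)} (hS : S ⊆ G.actionSpace) (i : ι) :
    Measurable fun q : S × (∀ i, UnitSphere (d i)) =>
      spsaEstimate G δ (realizedAction p r δ q.1.1 q.2) q.2 i := by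
  have h1 : Measurable fun q : S × (∀ i, UnitSphere (d i)) => realizedAction p r δ q.1.1 q.2 :=
    ((continuous_realizedAction p r δ).comp
      ((continuous_subtype_val.comp continuous_fst).prodMk continuous_snd)).measurable
  have h2 := measurable_payoff_comp hbdd h1
    (fun q => realizedAction_mem hr hball hδ hδr (hS q.1.2) q.2) i
  have h3 : Measurable fun q : S × (∀ i, UnitSphere (d i)) => (q.2 i).1 :=
    measurable_subtype_coe.comp ((measurable_pi_apply i).comp measurable_snd)
  exact (h2.const_mul _).smul h3

end Convergence

/-! ### Adaptedness of the pivots and convergence of the noise series. -/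

section BanditMirrorDescent

variable {ι : Type*} [Fintype ι] [DecidableEq ι] {d : ι → ℕ} {G : ConcaveGame ι d}
  {h : ∀ i, EuclideanSpace ℝ (Fin (d i)) → ℝ}
  {dh : ∀ i, EuclideanSpace ℝ (Fin (d i)) → EuclideanSpace ℝ (Fin (d i))}
  {p : Profile d} {r : ι → ℝ} {γ δ : ℕ → ℝ} {Ω : Type*} [mΩ : MeasurableSpace Ω] {P : Measure Ω}
  {X : ℕ → Ω → Profile d} {Z : ℕ → ∀ i, Ω → UnitSphere (d i)}

theorem IsBanditMirrorDescent.mem_pivotSet (hX : IsBanditMirrorDescent P G h dh p r γ δ X Z)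
    (n : ℕ) (ω : Ω) : X n ω ∈ pivotSet G h := by
  cases n with
  | zero => exact hX.init_mem ω
  | succ n => exact fun i => (hX.step n ω i).mem_subdiffDomain

/-- A new pivot is a continuous function `Q` of the dual vector `γ • estimate + dh X`, hence a
measurable function of the previous pivot and directions. Pivots are viewed in `pivotSet` because
`dh` is continuous only on the subdifferential domains. -/
theorem IsBanditMirrorDescent.measurable_pivot (hX : IsBanditMirrorDescent P G h dh p r γ δ X Z)
    (hbdd : G.HasBoundedMeasurablePayoffs) (hreg : ∀ i, IsRegularizer (G.act i) (h i) (dh i))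
    (hr : ∀ i, 0 < r i) (hball : ∀ i, Metric.closedBall (p i) (r i) ⊆ G.act i)
    (hδ : ∀ n, 0 < δ n) (hδr : ∀ n i, δ n < r i) (n : ℕ) :
    Measurable[pastFiltration hX.measurable_init hX.measurable_direction n]
      fun ω => (⟨X n ω, hX.mem_pivotSet n ω⟩ : pivotSet G h) := by
  induction n with
  | zero => exact (measurable_init_pastFiltration 0).subtype_mk
  | succ n ih =>
    refine Measurable.subtype_mk ?_
    refine @measurable_pi_lambda _ _ _
      (pastFiltration hX.measurable_init hX.measurable_direction (n + 1)) _ _ fun i => ?_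
    obtain ⟨Q, hQ, hQeq⟩ := (hreg i).exists_continuous_inverse_subdiff (G.isCompact_act i)
      ⟨p i, hball i (Metric.mem_closedBall_self (hr i).le)⟩
    have h1 : ∀ ω, X (n + 1) ω i = Q (γ n • spsaEstimate G (δ n)
        (realizedAction p r (δ n) (X n ω) (fun j => Z n j ω)) (fun j => Z n j ω) i +
          dh i (X n ω i)) := fun ω =>
      hQeq _ (hX.step n ω i).1 _ (hX.step n ω i).mem_subdiff
    simp only [h1]
    have h2 : Measurable[pastFiltration hX.measurable_init hX.measurable_direction (n + 1)]
        fun ω => ((⟨X n ω, hX.mem_pivotSet n ω⟩ : pivotSet G h), fun j => Z n j ω) :=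
      (ih.mono ((pastFiltration hX.measurable_init hX.measurable_direction).mono n.le_succ)
        le_rfl).prodMk (measurable_direction_pastFiltration n.lt_succ_self)
    have h3 : Continuous fun x : pivotSet G h => dh i (x.1 i) :=
      (hreg i).selection_continuousOn.comp_continuous
        ((continuous_apply i).comp continuous_subtype_val) fun x => x.2 i
    have h4 : Measurable fun q : pivotSet G h × (∀ i, UnitSphere (d i)) =>
        Q (γ n • spsaEstimate G (δ n) (realizedAction p r (δ n) q.1.1 q.2) q.2 i +
          dh i (q.1.1 i)) :=
      hQ.measurable.comp (((measurable_spsaEstimate hbdd hr hball (hδ n).le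
        (fun j => (hδr n j).le) pivotSet_subset_actionSpace i).const_smul (γ n)).add
          (h3.measurable.comp measurable_fst))
    have h5 := h4.comp h2
    simp only [Function.comp_def] at h5
    exact h5

/-- The noise of the payoff-weighted gradient estimates is summable along the process. -/
theorem IsBanditMirrorDescent.ae_exists_tendsto_sum_noise [IsProbabilityMeasure P]
    (hX : IsBanditMirrorDescent P G h dh p r γ δ X Z)
    (hbdd : G.HasBoundedMeasurablePayoffs) (hreg : ∀ i, IsRegularizer (G.act i) (h i) (dh i))
    (hr : ∀ i, 0 < r i) (hball : ∀ i, Metric.closedBall (p i) (r i) ⊆ G.act i)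
    (hγ : ∀ n, 0 < γ n) (hδ : ∀ n, 0 < δ n) (hδr : ∀ n i, δ n < r i) (hd : ∀ i, d i ≠ 0)
    (hsum : Summable fun n => γ n ^ 2 / δ n ^ 2) (w : ι → ℝ) (q : Profile d) :
    ∀ᵐ ω ∂P, ∃ s, Tendsto (fun n => ∑ k ∈ Finset.range n, γ k *
      (∑ i, w i * ⟪spsaEstimate G (δ k) (realizedAction p r (δ k) (X k ω) fun j => Z k j ω)
          (fun j => Z k j ω) i, X k ω i - q i⟫ -
        ∑ i, w i * ∫ z, ⟪spsaEstimate G (δ k) (realizedAction p r (δ k) (X k ω) z) z i,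
          X k ω i - q i⟫ ∂(Measure.pi fun j => uniformSphere (d j)))) atTop (𝓝 s) := by
  have hprob : ∀ j, IsProbabilityMeasure (uniformSphere (d j)) := fun j =>
    isProbabilityMeasure_uniformSphere (hd j)
  obtain ⟨ν, hν⟩ : ∃ ν, ν = Measure.pi fun j => uniformSphere (d j) := ⟨_, rfl⟩
  have : IsProbabilityMeasure ν := by rw [hν]; infer_instance
  rw [← hν]
  let H : ℕ → ι → pivotSet G h × (∀ j, UnitSphere (d j)) → ℝ := fun k i y =>
    ⟪spsaEstimate G (δ k) (realizedAction p r (δ k) y.1.1 y.2) y.2 i, y.1.1 i - q i⟫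
  have hHmeas : ∀ k i, Measurable (H k i) := fun k i => by
    have h1 := measurable_spsaEstimate hbdd hr hball (hδ k).le (fun j => (hδr k j).le)
      (pivotSet_subset_actionSpace (h := h)) i
    have h2 : Measurable fun y : pivotSet G h × (∀ j, UnitSphere (d j)) => y.1.1 i - q i :=
      ((measurable_pi_apply i).comp (measurable_subtype_coe.comp measurable_fst)).sub_const _
    exact h1.inner h2
  obtain ⟨C, hC0, hC⟩ := exists_norm_spsaEstimate_le (d := d) hbdd
  have hB : ∀ i, ∃ B : ℝ, ∀ y ∈ G.act i, ‖y - q i‖ ≤ B := fun i =>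
    (G.isCompact_act i).exists_bound_of_continuousOn (Continuous.continuousOn (by fun_prop))
  choose B hB using hB
  have hB0 : ∀ i, 0 ≤ B i := fun i =>
    (norm_nonneg _).trans (hB i _ (hball i (Metric.mem_closedBall_self (hr i).le)))
  have hHbdd : ∀ k i y, |H k i y| ≤ C / δ k * B i := fun k i y => by
    have hy := pivotSet_subset_actionSpace y.1.2
    exact (abs_real_inner_le_norm _ _).trans (mul_le_mul (hC _ (hδ k) _
      (realizedAction_mem hr hball (hδ k).le (fun j => (hδr k j).le) hy y.2) _ _)
      (hB i _ (hy i trivial)) (norm_nonneg _) (div_nonneg hC0 (hδ k).le))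
  have hHint : ∀ k i x, Integrable (fun z => H k i (x, z)) ν := fun k i x =>
    Integrable.of_bound ((hHmeas k i).comp measurable_prodMk_left).aestronglyMeasurable _
      (Eventually.of_forall fun z => hHbdd k i (x, z))
  have hmean : ∀ k i x, |∫ z, H k i (x, z) ∂ν| ≤ C / δ k * B i := fun k i x => by
    simpa using norm_integral_le_of_norm_le_const (μ := ν)
      (f := fun z => H k i (x, z)) (Eventually.of_forall fun z => hHbdd k i (x, z))
  -- The mean is taken with the pivot frozen, so `F k (x, ·)` is centered for every `x`.
  let F : ℕ → pivotSet G h × (∀ j, UnitSphere (d j)) → ℝ := fun k y =>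
    ∑ i, w i * H k i y - ∑ i, w i * ∫ z, H k i (y.1, z) ∂ν
  have hFmeas : ∀ k, Measurable (F k) := fun k => by
    refine (Finset.measurable_fun_sum _ fun i _ => (hHmeas k i).const_mul _).sub
      (Finset.measurable_fun_sum _ fun i _ => Measurable.const_mul ?_ _)
    exact ((hHmeas k i).stronglyMeasurable.integral_prod_right' (ν := ν)).measurable.comp
      measurable_fst
  have hF0 : ∀ k x, ∫ z, F k (x, z) ∂ν = 0 := fun k x => by
    have h1 : Integrable (fun z => ∑ i, w i * H k i (x, z)) ν :=
      integrable_finsetSum _ fun i _ => (hHint k i x).const_mul _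
    simp only [F]
    rw [integral_sub h1 (integrable_const _),
      integral_finsetSum _ fun i _ => (hHint k i x).const_mul _]
    simp [integral_const_mul]
  -- The factor `2` accounts for the estimate and its mean.
  let K : ℝ := 2 * C * ∑ i, |w i| * B i
  have hFbdd : ∀ k y, |F k y| ≤ K / δ k := fun k y => by
    have h1 : ∀ f : ι → ℝ, (∀ i, |f i| ≤ C / δ k * B i) →
        |∑ i, w i * f i| ≤ C / δ k * ∑ i, |w i| * B i := fun f hf => by
      rw [Finset.mul_sum]
      refine (Finset.abs_sum_le_sum_abs _ _).trans (Finset.sum_le_sum fun i _ => ?_)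
      rw [abs_mul]
      nlinarith [mul_le_mul_of_nonneg_left (hf i) (abs_nonneg (w i))]
    calc |F k y| ≤ _ := abs_sub _ _
      _ ≤ C / δ k * (∑ i, |w i| * B i) + C / δ k * ∑ i, |w i| * B i :=
          add_le_add (h1 _ fun i => hHbdd k i y) (h1 _ fun i => hmean k i y.1)
      _ = K / δ k := by simp only [K]; ring
  let 𝒢 := pastFiltration hX.measurable_init hX.measurable_direction
  have hpiv := hX.measurable_pivot hbdd hreg hr hball hδ hδr
  have hpair : ∀ k, Measurable[𝒢 (k + 1)]
      fun ω => ((⟨X k ω, hX.mem_pivotSet k ω⟩ : pivotSet G h), fun j => Z k j ω) := fun k =>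
    ((hpiv k).mono (𝒢.mono k.le_succ) le_rfl).prodMk
      (measurable_direction_pastFiltration k.lt_succ_self)
  have hZm : ∀ k, Measurable fun ω j => Z k j ω := fun k =>
    measurable_pi_lambda _ fun j => hX.measurable_direction k j
  refine ae_tendsto_sum_of_orthogonal 𝒢
    (η := fun k ω => γ k * F k (⟨X k ω, hX.mem_pivotSet k ω⟩, fun j => Z k j ω))
    (c := fun k => γ k * (K / δ k)) (fun k => ((hFmeas k).comp (hpair k)).const_mul _)
    (fun k ω => ?_) ?_ fun k Φ hΦ hΦb => ?_
  · rw [abs_mul, abs_of_pos (hγ k)]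
    exact mul_le_mul_of_nonneg_left (hFbdd k _) (hγ k).le
  · refine (hsum.mul_left (K ^ 2)).congr fun k => ?_
    ring
  · obtain ⟨M, hM⟩ := hΦb
    have h1 : ∀ ω, Φ ω * (γ k * F k (⟨X k ω, hX.mem_pivotSet k ω⟩, fun j => Z k j ω)) =
        γ k * (Φ ω * F k (⟨X k ω, hX.mem_pivotSet k ω⟩, fun j => Z k j ω)) := fun ω => by ring
    simp only [h1, integral_const_mul]
    rw [integral_mul_comp_eq_zero (𝒢.le k) (hpiv k) hΦ (hZm k)
      (indep_pastFiltration hX.indep_direction hX.indep_init k) (hFmeas k), mul_zero]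
    · rw [map_directions_eq_pi hX.measurable_direction hX.law_direction hX.indep_direction, ← hν]
      exact hF0 k
    · refine Integrable.of_bound ((hΦ.mono (𝒢.le k) le_rfl).mul ((hFmeas k).comp
        ((hpair k).mono (𝒢.le _) le_rfl))).aestronglyMeasurable (M * (K / δ k))
        (Eventually.of_forall fun ω => ?_)
      rw [norm_mul]
      exact mul_le_mul (hM ω) (hFbdd k _) (norm_nonneg _) ((abs_nonneg _).trans (hM ω))

end BanditMirrorDescent

theorem continuousOn_weightedGrad {ι : Type*} [Fintype ι] [DecidableEq ι] {d : ι → ℕ}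
    {G : ConcaveGame ι d} (hlip : G.HasLipschitzGradients) (w : ι → ℝ) (q : Profile d) :
    ContinuousOn (fun x : Profile d => ∑ i, w i * ⟪G.payoffGrad i x, x i - q i⟫)
      G.actionSpace := by
  refine continuousOn_finsetSum _ fun i _ => ContinuousOn.mul continuousOn_const ?_
  obtain ⟨L, hL⟩ := (hlip i).2
  exact hL.continuousOn.inner (Continuous.continuousOn (by fun_prop))

end

/-! ### The convergence theorem. -/

theorem theorem1 {ι : Type*} [Fintype ι] [DecidableEq ι] {d : ι → ℕ}
    (G : ConcaveGame ι d)
    (hbdd : G.HasBoundedMeasurablePayoffs)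
    (hlip : G.HasLipschitzGradients)
    (hmono : G.IsMonotone)
    (h : ∀ i, EuclideanSpace ℝ (Fin (d i)) → ℝ)
    (dh : ∀ i, EuclideanSpace ℝ (Fin (d i)) → EuclideanSpace ℝ (Fin (d i)))
    (hreg : ∀ i, IsRegularizer (G.act i) (h i) (dh i))
    (p : Profile d) (r : ι → ℝ) (hr : ∀ i, 0 < r i)
    (hball : ∀ i, Metric.closedBall (p i) (r i) ⊆ G.act i)
    (γ δ : ℕ → ℝ) (hγ : ∀ n, 0 < γ n) (hδ : ∀ n, 0 < δ n)
    (hδr : ∀ n i, δ n < r i)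
    (hγ_lim : Tendsto γ atTop (𝓝 0))
    (hδ_lim : Tendsto δ atTop (𝓝 0))
    (hγ_sum : Tendsto (fun n => ∑ k ∈ Finset.range n, γ k) atTop atTop)
    (hγδ_sum : Summable (fun n => γ n * δ n))
    (hγδ_sq_sum : Summable (fun n => γ n ^ 2 / δ n ^ 2))
    {Ω : Type*} [MeasurableSpace Ω] (P : Measure Ω) [IsProbabilityMeasure P]
    (X : ℕ → Ω → Profile d) (Z : ℕ → ∀ i, Ω → UnitSphere (d i))
    (hX : IsBanditMirrorDescent P G h dh p r γ δ X Z) :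
    ∃ x : Profile d, G.IsNash x ∧
      ∀ᵐ ω ∂P, Tendsto (fun n => realizedAction p r (δ n) (X n ω) (fun i => Z n i ω))
        atTop (𝓝 x) := by

  obtain ⟨w, hw, hmono⟩ := hmono
  -- In dimension zero the unit sphere is empty, but `Z 0 i` takes values in it.
  have hd : ∀ i, d i ≠ 0 := fun i hi => by
    obtain ⟨ω⟩ := P.nonempty_of_neZero
    have h1 := norm_eq_of_mem_sphere (Z 0 i ω)
    have h2 : IsEmpty (Fin (d i)) := by rw [hi]; infer_instance
    rw [Subsingleton.elim (Z 0 i ω : EuclideanSpace ℝ (Fin (d i))) 0, norm_zero] at h1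
    exact zero_ne_one h1
  obtain ⟨q, hq, hvar⟩ := ConcaveGame.exists_variational_solution hlip hmono
    ⟨p, fun i _ => hball i (Metric.mem_closedBall_self (hr i).le)⟩
  refine ⟨q, ConcaveGame.isNash_of_variational hlip hw hq hvar, ?_⟩
  have hne : ∀ i, (interior (G.act i)).Nonempty := fun i =>
    ⟨p i, interior_mono ((Metric.ball_subset_closedBall).trans (hball i))
      (by rw [Metric.isOpen_ball.interior_eq]; exact Metric.mem_ball_self (hr i))⟩
  let ψ : Profile d → ℝ := fun x => -∑ i, w i * ⟪G.payoffGrad i x, x i - q i⟫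
  -- Strict monotonicity between `q` and `x`, combined with the variational inequality at `q`.
  have hψpos : ∀ x ∈ G.actionSpace, x ≠ q → 0 < ψ x := fun x hx hxq => by
    have h1 := hmono q hq x hx hxq.symm
    have h2 := hvar x hx
    simp only [inner_sub_left, mul_sub, Finset.sum_sub_distrib] at h1
    simp only [ψ, inner_sub_right, mul_sub, Finset.sum_sub_distrib] at h1 h2 ⊢
    linarith
  have hψ0 : ∀ x ∈ G.actionSpace, 0 ≤ ψ x := fun x hx => by
    rcases eq_or_ne x q with rfl | hxq
    · simp [ψ]
    · exact (hψpos x hx hxq).le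
  obtain ⟨C₁, hC₁, hstep⟩ := exists_weightedBregman_prox_le hw hreg hne hq
  obtain ⟨C₂, hC₂, hspsa⟩ := exists_norm_spsaEstimate_le (d := d) hbdd
  choose C₃ hC₃ hbias using exists_abs_integral_spsaEstimate_sub_le hbdd hlip hr hball hd
  have hB : ∀ i, ∃ B : ℝ, ∀ y ∈ G.act i, ‖y - q i‖ ≤ B := fun i =>
    (G.isCompact_act i).exists_bound_of_continuousOn (Continuous.continuousOn (by fun_prop))
  choose B hB using hB
  let C₄ : ℝ := ∑ i, w i * (C₃ i * B i)
  have hpiv := hX.mem_pivotSet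
  have hact := fun n ω => pivotSet_subset_actionSpace (hpiv n ω)
  -- Only the noise series needs an exceptional null set; from here on the argument is pathwise.
  filter_upwards [hX.ae_exists_tendsto_sum_noise hbdd hreg hr hball hγ hδ hδr hd hγδ_sq_sum w q]
    with ω hω
  obtain ⟨s, hs⟩ := hω
  have hdrift : ∀ n, ∑ i, w i * ∫ z, ⟪spsaEstimate G (δ n) (realizedAction p r (δ n) (X n ω) z) z i,
      X n ω i - q i⟫ ∂(Measure.pi fun j => uniformSphere (d j)) ≤ -ψ (X n ω) + C₄ * δ n := by
    intro n
    simp only [ψ, C₄, neg_neg, Finset.sum_mul, ← Finset.sum_add_distrib]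
    refine Finset.sum_le_sum fun i _ => ?_
    have h1 := (abs_le.1 (hbias i _ (hδ n) (fun j => (hδr n j).le) _ (hact n ω)
      (X n ω i - q i))).2
    have h2 : C₃ i * δ n * ‖X n ω i - q i‖ ≤ C₃ i * δ n * B i :=
      mul_le_mul_of_nonneg_left (hB i _ (hact n ω i trivial)) (mul_nonneg (hC₃ i) (hδ n).le)
    have h3 := mul_le_mul_of_nonneg_left (h1.trans h2) (hw i).le
    linarith
  -- The realized pairing is split into its conditional mean, bounded by `hdrift`, and the centered
  -- noise.
  have hrec : ∀ n, weightedBregman w h dh q (X (n + 1) ω) ≤ weightedBregman w h dh q (X n ω) -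
      γ n * ψ (X n ω) + (γ n *
      (∑ i, w i * ⟪spsaEstimate G (δ n) (realizedAction p r (δ n) (X n ω) fun j => Z n j ω)
          (fun j => Z n j ω) i, X n ω i - q i⟫ -
        ∑ i, w i * ∫ z, ⟪spsaEstimate G (δ n) (realizedAction p r (δ n) (X n ω) z) z i,
          X n ω i - q i⟫ ∂(Measure.pi fun j => uniformSphere (d j))) +
        (C₄ * (γ n * δ n) + C₁ * C₂ ^ 2 * (γ n ^ 2 / δ n ^ 2))) := by
    intro n
    have h1 := hstep _ (hpiv n ω) _ _ _ _ (hγ n).le (hX.step n ω)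
      (hspsa _ (hδ n) _ (realizedAction_mem hr hball (hδ n).le (fun j => (hδr n j).le)
        (hact n ω) _) _)
    have h2 := mul_le_mul_of_nonneg_left (hdrift n) (hγ n).le
    have h3 : C₁ * (γ n * (C₂ / δ n)) ^ 2 = C₁ * C₂ ^ 2 * (γ n ^ 2 / δ n ^ 2) := by ring
    rw [h3] at h1
    linarith
  have herr : Tendsto (fun n => ∑ k ∈ Finset.range n,
      (C₄ * (γ k * δ k) + C₁ * C₂ ^ 2 * (γ k ^ 2 / δ k ^ 2))) atTop
      (𝓝 (∑' k, (C₄ * (γ k * δ k) + C₁ * C₂ ^ 2 * (γ k ^ 2 / δ k ^ 2)))) :=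
    ((hγδ_sum.mul_left C₄).add (hγδ_sq_sum.mul_left (C₁ * C₂ ^ 2))).hasSum.tendsto_sum_nat
  have herr' := hs.add herr
  simp only [← Finset.sum_add_distrib] at herr'
  obtain ⟨hsum, l, hl⟩ := exists_tendsto_of_le_sub_add
    (fun n => weightedBregman_nonneg hw hreg hq (hpiv n ω))
    (fun n => mul_nonneg (hγ n).le (hψ0 _ (hact n ω))) herr' hrec
  have hlim : Tendsto (fun n => X n ω) atTop (𝓝 q) :=
    tendsto_of_frequently_lt hw hreg hq (continuousOn_weightedGrad hlip w q).neg hψpos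
      (fun n => hpiv n ω) hl fun ε hε => frequently_lt_of_summable_mul hγ hγ_sum hsum hε
  obtain ⟨D, hD, hDle⟩ := exists_norm_realizedAction_sub_le G p r
  refine tendsto_pi_nhds.2 fun i => ?_
  have h1 : Tendsto (fun n => realizedAction p r (δ n) (X n ω) (fun j => Z n j ω) i - X n ω i)
      atTop (𝓝 0) := by
    have h2 := hδ_lim.const_mul D
    rw [mul_zero] at h2
    exact squeeze_zero_norm (fun n => (hDle _ (hδ n).le _ (hact n ω) _).1 i) h2
  have h2 := h1.add (tendsto_pi_nhds.1 hlim i)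
  simpa using h2
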